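/- **Model.** UAVs at height $h_v\ge 0$ project to a homogeneous Poisson point process of density $\lambda>0$ on $\mathbb R^2$, ranked by distance to the origin: $\|v_1\|<\|v_2\|<\cdots$. The typical BS is above the origin at height $h_b\ge 0$. Put $\Delta h=|h_v-h_b|$, $r_1=\|v_1\|$, and $\gamma(r)=\lfloor r\sqrt{\beta_a\beta_b}\rfloor$ with $\beta_a,\beta_b>0$. A link of horizontal length $r$ is LOS ($\kappa=L$) with probability $p_L(\gamma(r))$ and otherwise NLOS ($\kappa=N$), $p_N=1-p_L$, where $p_L(0)=1$ and, for $k\ge1$ and a fixed $\varepsilon>0$, $$p_L(k)=\prod_{n=0}^{k}\Bigl(1-\exp\Bigl(-\frac{(k\max(h_v,h_b)-(n+\frac12)\Delta h)^2}{2\varepsilon^2k^2}\Bigr)\Bigr).$$ A link in state $\kappa$ has path loss $C_\kappa(r^2+\Delta h^2)^{-\alpha_\kappa/2}$, with $C_\kappa>0$ and $\alpha_\kappa\ge 2$, and squared fading amplitude $|\hat h|^2$ that is Gamma distributed with shape and rate $\mathcal N_\kappa\in\{1,2,\dots\}$. With beamwidths $\theta^a_c\in[0,2\pi]$, $\theta^e_c\in[0,\pi]$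 and gains $M_c,m_c\ge0$ ($c\in\{t,r\}$), put $q_c=\frac{\theta_c^a}{2\pi}\frac{\theta_c^e}{\pi}$. The directivity gain $G$ of an interferer equals $o_i$ with probability $p_i$, where $(o_1,\dots,o_4)=(M_tM_r,\,m_tM_r,\,M_tm_r,\,m_tm_r)$ and $(p_1,\dots,p_4)=(q_tq_r,\,(1-q_t)q_r,\,q_t(1-q_r),\,(1-q_t)(1-q_r))$. Given all positions, the marks (state, gain, fading) of different interferers are independent; for one interferer, the gain is independent of the state and the fading. Let $I=\sum_{n\ge2}(\text{path loss}\times G\times|\hat h|^2)_{v_n}\in[0,\infty]$. **Claim.** For every $s\ge0$, almost surely $$\mathbb E\bigl[e^{-sI}\,\big|\,r_1\bigr]=\exp\Bigl(-2\pi\lambda\sum_{i=1}^4p_i\bigl(\Theta^L(s,o_i|r_1)+\Theta^N(s,o_i|r_1)\bigr)\Bigr),$$ where, with $\gamma=\gamma(r_1)$, $$\Theta^\kappa(s,o|r_1)=p_\kappa(\gamma)\,Z^\kappa\Bigl(s,r_1,\tfrac{\gamma+1}{\sqrt{\beta_a\beta_b}},o\Bigr)+\sum_{j=\gamma+1}^\infty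 p_\kappa(j)\,Z^\kappa\Bigl(s,\tfrac{j}{\sqrt{\beta_a\beta_b}},\tfrac{j+1}{\sqrt{\beta_a\beta_b}},o\Bigr),$$ $$Z^\kappa(s,a,b,o)=\frac{a^2+\Delta h^2}{2}F^\kappa_{\alpha_\kappa}\Bigl(\frac{sC_\kappa o}{\mathcal N_\kappa(a^2+\Delta h^2)^{\alpha_\kappa/2}}\Bigr)-\frac{b^2+\Delta h^2}{2}F^\kappa_{\alpha_\kappa}\Bigl(\frac{sC_\kappa o}{\mathcal N_\kappa(b^2+\Delta h^2)^{\alpha_\kappa/2}}\Bigr).$$ For $\alpha_\kappa>2$, $F^\kappa_{\alpha_\kappa}(z)={}_2F_1\bigl(-\frac2{\alpha_\kappa},\mathcal N_\kappa;1-\frac2{\alpha_\kappa};-z\bigr)-1$, with ${}_2F_1$ the Gauss hypergeometric function (continued analytically to $\mathbb C\setminus[1,\infty)$). For $\alpha_\kappa=2$, $$F_2^\kappa(z)=\sum_{c=1}^{\mathcal N_\kappa-1}\frac{z\,\mathcal N_\kappa}{(z+1)^{\mathcal N_\kappa-c}(\mathcal N_\kappa-c)}+\frac{1-(z+1)^{\mathcal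 N_\kappa-1}}{(z+1)^{\mathcal N_\kappa-1}}-z\,\mathcal N_\kappa\ln\Bigl(1+\frac1z\Bigr)\quad(z>0),\qquad F_2^\kappa(0)=0.$$ For every $r_1>0$ the series in $\Theta^L$ converges, and so does the series in $\Theta^N$ if $\alpha_N>2$. If $\alpha_N=2$, the series in $\Theta^N$ may diverge to $+\infty$; the right-hand side is then read as the limit obtained from the partial sums of the series (that is, $e^{-\infty}=0$, with $e^{-s\cdot\infty}=0$ for $s>0$ and $=1$ for $s=0$ on the left). -/

import Mathlib

open MeasureTheory ProbabilityTheory Filter Topology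
open scoped ENNReal NNReal

/-- The state of a link: `L` is line of sight (LOS), `N` is non line of sight (NLOS). -/
inductive Link : Type
  | L : Link
  | N : Link

instance : MeasurableSpace Link := ⊤

/-! ### Poisson point processes -/

/-- The random measure `Φ` is a Poisson point process with intensity measure `Λ`: the number of
points in a set of finite intensity is Poisson distributed with that mean, and the numbers of
points in pairwise disjoint sets are independent. -/
structure IsPoissonPointProcess {Ω E : Type*} [MeasurableSpace Ω] [MeasurableSpace E]
    (μ : Measure Ω) (Φ : Ω → Measure E) (Λ : Measure E) : Prop where
  measurable_count : ∀ A : Set E, MeasurableSet A → Measurable fun ω => Φ ω A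
  count_law : ∀ A : Set E, MeasurableSet A → Λ A < ∞ →
    μ.map (fun ω => Φ ω A) = (poissonMeasure (Λ A).toNNReal).map (fun k : ℕ => (k : ℝ≥0∞))
  count_indep : ∀ (m : ℕ) (A : Fin m → Set E), (∀ i, MeasurableSet (A i)) →
    (Pairwise fun i j => Disjoint (A i) (A j)) → iIndepFun (fun i ω => Φ ω (A i)) μ

/-! ### Parameters of the downlink network -/

structure DownlinkParams where
  /-- density of the UAVs -/
  lam : ℝ
  /-- height of the UAVs -/
  hv : ℝ
  /-- height of the BSs -/
  hb : ℝ
  /-- ratio of the obstacle area to the total area -/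
  betaA : ℝ
  /-- density of the obstacles -/
  betaB : ℝ
  /-- scale of the Rayleigh distributed obstacle heights -/
  eps : ℝ
  /-- intercepts -/
  C : Link → ℝ
  /-- path loss exponents -/
  α : Link → ℝ
  /-- Nakagami fading parameters -/
  Nak : Link → ℕ
  /-- half-power beamwidths: transmitter / receiver (`t` / `r`), azimuth / elevation (`a` / `e`) -/
  θta : ℝ
  θte : ℝ
  θra : ℝ
  θre : ℝ
  /-- main beam gains -/
  Mt : ℝ
  Mr : ℝ
  /-- side lobe gains -/
  mt : ℝ
  mr : ℝ

namespace DownlinkParams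

/-- The physically meaningful ranges of the parameters. -/
structure Admissible (P : DownlinkParams) : Prop where
  lam_pos : 0 < P.lam
  hv_nonneg : 0 ≤ P.hv
  hb_nonneg : 0 ≤ P.hb
  betaA_pos : 0 < P.betaA
  betaB_pos : 0 < P.betaB
  eps_pos : 0 < P.eps
  C_pos : ∀ κ, 0 < P.C κ
  Nak_pos : ∀ κ, 1 ≤ P.Nak κ
  θta_mem : P.θta ∈ Set.Icc 0 (2 * Real.pi)
  θte_mem : P.θte ∈ Set.Icc 0 Real.pi
  θra_mem : P.θra ∈ Set.Icc 0 (2 * Real.pi)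
  θre_mem : P.θre ∈ Set.Icc 0 Real.pi
  Mt_nonneg : 0 ≤ P.Mt
  Mr_nonneg : 0 ≤ P.Mr
  mt_nonneg : 0 ≤ P.mt
  mr_nonneg : 0 ≤ P.mr

noncomputable section

variable (P : DownlinkParams)

/-- The height difference between UAVs and BSs. -/
def dh : ℝ := |P.hv - P.hb|

/-- The number `√(β_a β_b)` of obstacles met per unit length. -/
def rate : ℝ := √(P.betaA * P.betaB)

/-- `γ(r) = ⌊r √(β_a β_b)⌋`. -/
def γ (r : ℝ) : ℕ := ⌊r * P.rate⌋₊

/-- The probability of a LOS link, as a function of `k = γ(r)`. For `k = 0` (no obstacle between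
the two ends) the exponent in the general expression is `-(⋯) / 0 = -∞`, so the value is `1`. -/
def losProb (k : ℕ) : ℝ :=
  if k = 0 then 1 else
    ∏ n ∈ Finset.range (k + 1),
      (1 - Real.exp (-((k * max P.hv P.hb - (n + 1 / 2) * P.dh) ^ 2
        / (2 * P.eps ^ 2 * (k : ℝ) ^ 2))))

/-- The probability `p_κ(k)` that a link with `γ(r) = k` is in the state `κ`. -/
def linkProb : Link → ℕ → ℝ
  | Link.L, k => P.losProb k
  | Link.N, k => 1 - P.losProb k

/-- The path loss at horizontal distance `r` of a link in the state `κ`. -/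
def pathLoss (κ : Link) (r : ℝ) : ℝ :=
  P.C κ / √((r ^ 2 + P.dh ^ 2) ^ P.α κ)

/-- The probability that a transmitter, resp. receiver, points its main beam. -/
def qt : ℝ := P.θta / (2 * Real.pi) * (P.θte / Real.pi)
def qr : ℝ := P.θra / (2 * Real.pi) * (P.θre / Real.pi)

/-- The four directivity gains `o_i`. -/
def gain : Fin 4 → ℝ :=
  ![P.Mt * P.Mr, P.mt * P.Mr, P.Mt * P.mr, P.mt * P.mr]

/-- The probabilities `p_i` of the four directivity gains. -/
def gainProb : Fin 4 → ℝ :=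
  ![P.qt * P.qr, (1 - P.qt) * P.qr, P.qt * (1 - P.qr), (1 - P.qt) * (1 - P.qr)]

end

end DownlinkParams

/-! ### The downlink network -/

/-- The downlink network on a probability space, seen from the typical BS at the origin.
* `v 0, v 1, …` are the UAVs, ranked by their distance to the origin; they form a homogeneous
  Poisson point process on the plane. The UAV `v 0` is the serving one; the interferers are
  `v 1, v 2, …`.
* `link n`, `pat n`, `fad n` are the link state, the gain pattern and the squared fading amplitude
  of the interferer `v (n + 1)`. Given all positions, these marks are independent over `n`; the
  link state is `κ` with probability `p_κ(γ(‖v (n + 1)‖))`, the pattern is `i` with probability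
  `p_i` independently of the state, and the squared fading amplitude of a link in the state `κ` is
  a normalized Gamma variable with parameter `N_κ`. -/
structure IsDownlinkNetwork {Ω : Type*} [MeasurableSpace Ω] (μ : Measure Ω) (P : DownlinkParams)
    (v : ℕ → Ω → EuclideanSpace ℝ (Fin 2)) (link : ℕ → Ω → Link) (pat : ℕ → Ω → Fin 4)
    (fad : ℕ → Ω → ℝ) : Prop where
  measurable_v : ∀ n, Measurable (v n)
  measurable_link : ∀ n, Measurable (link n)
  measurable_pat : ∀ n, Measurable (pat n)
  measurable_fad : ∀ n, Measurable (fad n)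
  ranked : ∀ᵐ ω ∂μ, StrictMono fun n => ‖v n ω‖
  poisson : IsPoissonPointProcess μ (fun ω => Measure.sum fun n => Measure.dirac (v n ω))
    (ENNReal.ofReal P.lam • volume)
  marks : ∀ (B : Set (ℕ → EuclideanSpace ℝ (Fin 2))), MeasurableSet B →
    ∀ (S : Finset ℕ) (κ : ℕ → Link) (i : ℕ → Fin 4) (T : ℕ → Set ℝ),
      (∀ n, MeasurableSet (T n)) →
      μ {ω | (fun n => v n ω) ∈ B ∧ ∀ n ∈ S, link n ω = κ n ∧ pat n ω = i n ∧ fad n ω ∈ T n} =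
        ∫⁻ ω in {ω | (fun n => v n ω) ∈ B},
          ∏ n ∈ S, ENNReal.ofReal (P.linkProb (κ n) (P.γ ‖v (n + 1) ω‖)) *
            ENNReal.ofReal (P.gainProb (i n)) *
            gammaMeasure (P.Nak (κ n)) (P.Nak (κ n)) (T n) ∂μ

noncomputable section

/-- The received power of interference: the sum over all UAVs except the nearest one of
path loss × directivity gain × squared fading amplitude (possibly `∞`). -/
def interference {Ω : Type*} (P : DownlinkParams) (v : ℕ → Ω → EuclideanSpace ℝ (Fin 2))
    (link : ℕ → Ω → Link) (pat : ℕ → Ω → Fin 4) (fad : ℕ → Ω → ℝ) (ω : Ω) : ℝ≥0∞ :=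
  ∑' n, ENNReal.ofReal
    (P.pathLoss (link n ω) ‖v (n + 1) ω‖ * P.gain (pat n ω) * fad n ω)

/-- `exp (-x)` for `x ∈ [0, ∞]`, with `exp (-∞) = 0`. -/
def expNeg (x : ℝ≥0∞) : ℝ := if x = ∞ then 0 else Real.exp (-x.toReal)

/-- The σ-algebra generated by the distance `r₁` of the nearest UAV. -/
@[reducible] def nearestSigma {Ω : Type*} (v : ℕ → Ω → EuclideanSpace ℝ (Fin 2)) : MeasurableSpace Ω :=
  MeasurableSpace.comap (fun ω => ‖v 0 ω‖) inferInstance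

/-- The conditional Laplace transform `E[exp (-s I) | r₁]` of the interference. -/
def condLaplace {Ω : Type*} [MeasurableSpace Ω] (μ : Measure Ω) (P : DownlinkParams)
    (v : ℕ → Ω → EuclideanSpace ℝ (Fin 2)) (link : ℕ → Ω → Link) (pat : ℕ → Ω → Fin 4)
    (fad : ℕ → Ω → ℝ) (s : ℝ) : Ω → ℝ :=
  condExp (nearestSigma v) μ
    (fun ω => expNeg (ENNReal.ofReal s * interference P v link pat fad ω))

/-! ### The Gauss hypergeometric function and the closed forms -/

/-- `f` is the holomorphic continuation of the hypergeometric series with parameters `a, b; c`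
from the unit disc to the plane cut along `[1, ∞)`. -/
def IsHypergeometricContinuation (a b c : ℂ) (f : ℂ → ℂ) : Prop :=
  DifferentiableOn ℂ f {z | 1 - z ∈ Complex.slitPlane} ∧
    Set.EqOn f (fun z => ordinaryHypergeometric a b c z) (Metric.ball 0 1)

open Classical in
/-- The Gauss hypergeometric function `₂F₁(a, b; c; z)` on the cut plane. -/
def gaussHypergeometric (a b c z : ℂ) : ℂ :=
  if h : ∃ f, IsHypergeometricContinuation a b c f then h.choose z else 0

/-- `F_α` for `α > 2` (and Nakagami parameter `N`). -/
def FGeneric (α : ℝ) (N : ℕ) (z : ℝ) : ℝ :=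
  (gaussHypergeometric ((-2 / α : ℝ) : ℂ) (N : ℂ) ((1 - 2 / α : ℝ) : ℂ) ((-z : ℝ) : ℂ)).re - 1

/-- `F_α` for `α = 2`; the sum over `c` is empty for `N = 1`. -/
def FTwo (N : ℕ) (z : ℝ) : ℝ :=
  ∑ c ∈ Finset.Icc 1 (N - 1), z * N / ((z + 1) ^ (N - c) * ((N : ℝ) - c))
    + (1 - (z + 1) ^ (N - 1)) / (z + 1) ^ (N - 1)
    - z * N * Real.log (1 + 1 / z)

/-- The function `F_α`, for `α ≥ 2`. -/
def FAlpha (α : ℝ) (N : ℕ) (z : ℝ) : ℝ :=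
  if α = 2 then FTwo N z else FGeneric α N z

namespace DownlinkParams

variable (P : DownlinkParams)

/-- One of the two terms whose difference is `Z^κ`. -/
def ZPart (κ : Link) (s a g : ℝ) : ℝ :=
  (a ^ 2 + P.dh ^ 2) / 2 *
    FAlpha (P.α κ) (P.Nak κ) (s * P.C κ * g / (P.Nak κ * (a ^ 2 + P.dh ^ 2) ^ (P.α κ / 2)))

/-- `Z^κ(s, a, b, g)`. -/
def Z (κ : Link) (s a b g : ℝ) : ℝ := P.ZPart κ s a g - P.ZPart κ s b g

/-- The contribution to `Θ^κ` of the annulus that contains `r₁`. -/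
def thetaHead (κ : Link) (s g r₁ : ℝ) : ℝ :=
  P.linkProb κ (P.γ r₁) * P.Z κ s r₁ ((P.γ r₁ + 1) / P.rate) g

/-- The contribution to `Θ^κ` of the `j`-th annulus. -/
def thetaTerm (κ : Link) (s g : ℝ) (j : ℕ) : ℝ :=
  P.linkProb κ j * P.Z κ s (j / P.rate) ((j + 1) / P.rate) g

/-- `Θ^κ(s, g | r₁)`; the series runs over the annuli `j = γ(r₁) + 1 + m`, `m = 0, 1, …`. -/
def Theta (κ : Link) (s g r₁ : ℝ) : ℝ :=
  P.thetaHead κ s g r₁ + ∑' m : ℕ, P.thetaTerm κ s g (P.γ r₁ + 1 + m)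

/-- `Θ^κ(s, g | r₁)` with the series cut off after `J` annuli. -/
def ThetaPartial (J : ℕ) (κ : Link) (s g r₁ : ℝ) : ℝ :=
  P.thetaHead κ s g r₁ + ∑ m ∈ Finset.range J, P.thetaTerm κ s g (P.γ r₁ + 1 + m)

end DownlinkParams

end

/-! ### The function `expNeg` -/

/-! Three averages produce the formula. First, given all positions the marks are independent, so the
conditional mean of `exp (-s I)` is the product over the interferers of `markLaplace`, a mixture
over link state and gain of the Gamma transforms `(1 + s b / N)⁻ᴺ`
(`setIntegral_expNeg_interference`). This product is `expNeg` of the sum of the values `-log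
markLaplace`, hence a functional of the point process alone. Second, given the nearest distance
`r₁`, the other points form a Poisson process outside the disc of radius `r₁`
(`setIntegral_expNeg_nearest`, from the Laplace functional `IsPoissonPointProcess.laplace`). The
conditional transform is therefore `exp (-λ ∫ (1 - markLaplace))` over `‖x‖ > r₁`
(`condLaplace_ae_eq`). Third, polar coordinates turn the exponent into `2πλ ∫ r (1 - markLaplace r)
dr`. The link probabilities are constant on the annuli `[j / rate, (j + 1) / rate)`, and on each
annulus the radial integral is elementary once `F_α` is known.

The closed forms enter through one differential equation, `z F' = (2/α) (F + 1 - (1 + z)⁻ᴺ)`,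
satisfied by both the hypergeometric and the logarithmic `F_α` (`hasDerivAt_FAlpha`). It makes
`-ZPart` a primitive of `r (1 - linkLaplace r)` (`hasDerivAt_ZPart`). The equation leaves a multiple
of `z^(2/α)` undetermined, but this adds a constant to `ZPart` and disappears from the difference
`Z`. For `α > 2` the equation comes from an integral representation of `₂F₁` on the cut plane,
identified with the hypergeometric function by the identity theorem.

Hence the partial sums of `Θ` are radial integrals over bounded annuli, and monotone convergence in
the outer radius gives the limit whether or not the series converge. Separate bounds show
convergence: geometric decay of the LOS probability for `L`, and `r^(1-α)` decay for `α > 2`.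

Sums and integrals stay in `[0, ∞]` and are exponentiated by `expNeg`, which is continuous including
at `∞` and bounded by `1`; infinite interference then needs no separate treatment. -/

theorem expNeg_eq_toReal_exp (x : ℝ≥0∞) : expNeg x = (EReal.exp (-(x : EReal))).toReal := by
  induction x with
  | top => simp [expNeg]
  | coe x =>
    have : (-((x : ℝ≥0∞) : EReal)) = ((-(x : ℝ) : ℝ) : EReal) := rfl
    rw [this, EReal.exp_coe, ENNReal.toReal_ofReal (Real.exp_pos _).le]
    simp [expNeg]

theorem continuous_expNeg : Continuous expNeg := by
  have h : expNeg = fun x : ℝ≥0∞ => (EReal.exp (-(x : EReal))).toReal :=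
    funext expNeg_eq_toReal_exp
  rw [h]
  refine ENNReal.continuousOn_toReal.comp_continuous
    (ENNReal.continuous_exp.comp (continuous_neg.comp continuous_coe_ennreal_ereal)) fun x => ?_
  simp only [Set.mem_ofPred_eq, ne_eq, EReal.exp_eq_top_iff]
  intro hx
  rw [EReal.neg_eq_top_iff] at hx
  exact EReal.coe_ennreal_ne_bot x hx

@[fun_prop]
theorem measurable_expNeg : Measurable expNeg := continuous_expNeg.measurable

theorem expNeg_nonneg (x : ℝ≥0∞) : 0 ≤ expNeg x := by
  unfold expNeg; split_ifs <;> positivity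

theorem expNeg_le_one (x : ℝ≥0∞) : expNeg x ≤ 1 := by
  unfold expNeg; split_ifs
  · exact zero_le_one
  · simp

@[simp] theorem expNeg_zero : expNeg 0 = 1 := by simp [expNeg]

@[simp] theorem expNeg_top : expNeg ∞ = 0 := by simp [expNeg]

theorem expNeg_ofReal {x : ℝ} (hx : 0 ≤ x) : expNeg (ENNReal.ofReal x) = Real.exp (-x) := by
  simp [expNeg, ENNReal.toReal_ofReal hx]

theorem expNeg_coe (x : ℝ≥0) : expNeg x = Real.exp (-x) := by simp [expNeg]

theorem expNeg_add (x y : ℝ≥0∞) : expNeg (x + y) = expNeg x * expNeg y := by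
  induction x with
  | top => simp
  | coe x =>
    induction y with
    | top => simp
    | coe y =>
      rw [← ENNReal.coe_add]
      simp only [expNeg_coe, NNReal.coe_add]
      rw [← Real.exp_add]; ring_nf

theorem expNeg_sum {ι : Type*} (S : Finset ι) (f : ι → ℝ≥0∞) :
    expNeg (∑ i ∈ S, f i) = ∏ i ∈ S, expNeg (f i) := by
  classical
  induction S using Finset.induction_on with
  | empty => simp
  | insert a S ha ih => rw [Finset.sum_insert ha, Finset.prod_insert ha, expNeg_add, ih]

theorem norm_expNeg_le (x : ℝ≥0∞) : ‖expNeg x‖ ≤ 1 := by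
  rw [Real.norm_of_nonneg (expNeg_nonneg x)]; exact expNeg_le_one x

theorem integrable_expNeg {Ω : Type*} [MeasurableSpace Ω] {μ : Measure Ω} [IsFiniteMeasure μ]
    {f : Ω → ℝ≥0∞} (hf : AEMeasurable f μ) : Integrable (fun ω => expNeg (f ω)) μ :=
  Integrable.of_bound (measurable_expNeg.comp_aemeasurable hf).aestronglyMeasurable 1
    (ae_of_all _ fun _ => norm_expNeg_le _)

/-- The bound `expNeg ≤ 1` supplies the domination, so the functions themselves need no bound and
the limit may be `∞`. -/
theorem tendsto_integral_expNeg {Ω : Type*} [MeasurableSpace Ω] {μ : Measure Ω}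
    [IsFiniteMeasure μ] {f : ℕ → Ω → ℝ≥0∞} {g : Ω → ℝ≥0∞} (hf : ∀ n, AEMeasurable (f n) μ)
    (h : ∀ᵐ ω ∂μ, Tendsto (fun n => f n ω) atTop (𝓝 (g ω))) :
    Tendsto (fun n => ∫ ω, expNeg (f n ω) ∂μ) atTop (𝓝 (∫ ω, expNeg (g ω) ∂μ)) := by
  refine tendsto_integral_of_dominated_convergence (fun _ => 1)
    (fun n => (measurable_expNeg.comp_aemeasurable (hf n)).aestronglyMeasurable)
    (integrable_const _) (fun n => ae_of_all _ fun _ => norm_expNeg_le _) ?_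
  filter_upwards [h] with ω hω
  exact (continuous_expNeg.tendsto _).comp hω

/-! ### The Laplace functional of a Poisson point process -/

theorem integral_exp_neg_mul_poissonMeasure (r y : ℝ≥0) :
    ∫ k : ℕ, Real.exp (-(y * k : ℝ)) ∂(poissonMeasure r) =
      Real.exp (-(r * (1 - Real.exp (-y)))) := by
  rw [integral_poissonMeasure]
  have h : ∀ n : ℕ, (Real.exp (-r) * r ^ n / n.factorial) • Real.exp (-(y * n : ℝ)) =
      Real.exp (-r) * ((r * Real.exp (-y)) ^ n / n.factorial) := by
    intro n
    rw [smul_eq_mul, mul_pow, ← Real.exp_nat_mul]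
    ring_nf
  simp_rw [h]
  rw [tsum_mul_left, (NormedSpace.expSeries_div_hasSum_exp (r * Real.exp (-y) : ℝ)).tsum_eq,
    ← Real.exp_eq_exp_ℝ, ← Real.exp_add]
  ring_nf

namespace IsPoissonPointProcess

variable {Ω E : Type*} [MeasurableSpace Ω] [MeasurableSpace E] {μ : Measure Ω}
  {Φ : Ω → Measure E} {Λ : Measure E}

theorem measurable (h : IsPoissonPointProcess μ Φ Λ) : Measurable Φ :=
  Measure.measurable_of_measurable_coe _ h.measurable_count

theorem measurable_lintegral (h : IsPoissonPointProcess μ Φ Λ) {f : E → ℝ≥0∞}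
    (hf : Measurable f) : Measurable fun ω => ∫⁻ x, f x ∂(Φ ω) :=
  (Measure.measurable_lintegral hf).comp h.measurable

theorem count_indep_fintype (h : IsPoissonPointProcess μ Φ Λ) {ι : Type*} [Fintype ι]
    (A : ι → Set E) (hA : ∀ i, MeasurableSet (A i))
    (hd : Pairwise fun i j => Disjoint (A i) (A j)) :
    iIndepFun (fun i ω => Φ ω (A i)) μ := by
  classical
  let e := Fintype.equivFin ι
  have := h.count_indep (Fintype.card ι) (fun k => A (e.symm k)) (fun k => hA _)
    (fun i j hij => hd fun hh => hij (e.symm.injective hh))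
  have h2 := this.precomp e.injective
  simpa using h2

theorem integral_expNeg_mul_count (h : IsPoissonPointProcess μ Φ Λ) {A : Set E}
    (hA : MeasurableSet A) (hfin : Λ A < ∞) (y : ℝ≥0) :
    ∫ ω, expNeg (y * Φ ω A) ∂μ = expNeg (ENNReal.ofReal (1 - expNeg y) * Λ A) := by
  have h1 : ∫ ω, expNeg (y * Φ ω A) ∂μ = ∫ x, expNeg (y * x) ∂(μ.map fun ω => Φ ω A) := by
    rw [integral_map (h.measurable_count A hA).aemeasurable]
    exact (by fun_prop : Measurable fun x : ℝ≥0∞ => expNeg (y * x)).aestronglyMeasurable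
  rw [h1, h.count_law A hA hfin, integral_map Measurable.of_discrete.aemeasurable
    (by fun_prop : Measurable fun x : ℝ≥0∞ => expNeg (y * x)).aestronglyMeasurable]
  have h2 : ∀ k : ℕ, expNeg ((y : ℝ≥0∞) * (k : ℝ≥0∞)) = Real.exp (-(y * k : ℝ)) := by
    intro k
    have : ((y : ℝ≥0∞) * (k : ℝ≥0∞)) = ((y * k : ℝ≥0) : ℝ≥0∞) := by push_cast; rfl
    rw [this, expNeg_coe]; push_cast; rfl
  simp_rw [h2]
  have h0 : 0 ≤ 1 - Real.exp (-(y : ℝ)) := by simp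
  rw [integral_exp_neg_mul_poissonMeasure, expNeg_coe, ← ENNReal.ofReal_toReal hfin.ne,
    ← ENNReal.ofReal_mul h0, expNeg_ofReal (by positivity)]
  simp [mul_comm, ENNReal.toReal]

/-- The integral of a simple function is a combination of the counts of its level sets, which are
disjoint. Independence factors the expectation, and each factor is a Poisson transform. -/
theorem laplace_simpleFunc (h : IsPoissonPointProcess μ Φ Λ) (f : SimpleFunc E ℝ≥0)
    (hfin : ∀ y, y ≠ 0 → Λ (f ⁻¹' {y}) < ∞) :
    ∫ ω, expNeg (∫⁻ x, f x ∂(Φ ω)) ∂μ =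
      expNeg (∫⁻ x, ENNReal.ofReal (1 - expNeg (f x)) ∂Λ) := by
  classical
  -- The value `0` is dropped: its level set may have infinite intensity, and it contributes nothing
  -- to either side.
  obtain ⟨S, hS⟩ : ∃ S : Finset ℝ≥0, S = f.range.filter (· ≠ 0) := ⟨_, rfl⟩
  have key : ∀ (ψ : ℝ≥0 → ℝ≥0∞) (_ : ψ 0 = 0) (ν : Measure E), ∫⁻ x, ψ (f x) ∂ν =
      ∑ y : S, ψ y * ν (f ⁻¹' {y.1}) := by
    intro ψ hψ ν
    have h1 : ∫⁻ x, ψ (f x) ∂ν = (f.map ψ).lintegral ν := by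
      rw [← SimpleFunc.lintegral_eq_lintegral]; rfl
    rw [h1, SimpleFunc.map_lintegral, Finset.sum_coe_sort S
      (fun y => ψ y * ν (f ⁻¹' {y})), hS, Finset.sum_filter]
    refine Finset.sum_congr rfl fun y _ => ?_
    by_cases hy : y = 0 <;> simp [hy, hψ]
  have h1 : ∀ ω, expNeg (∫⁻ x, f x ∂(Φ ω)) =
      ∏ y : S, expNeg (y.1 * Φ ω (f ⁻¹' {y.1})) := by
    intro ω
    rw [key (fun y => (y : ℝ≥0∞)) (by simp), expNeg_sum]
  simp_rw [h1]
  rw [key (fun y => ENNReal.ofReal (1 - expNeg y)) (by simp), expNeg_sum]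
  have hind := h.count_indep_fintype
    (fun y : S => f ⁻¹' {y.1})
    (fun y => f.measurableSet_preimage _)
    (fun i j hij => Disjoint.preimage _ (by simpa using fun hh => hij (Subtype.ext hh)))
  rw [hind.integral_fun_prod_comp (f := fun y x => expNeg (y.1 * x))
    (fun y => (h.measurable_count _ (f.measurableSet_preimage _)).aemeasurable)
    (fun y => (by fun_prop :
      Measurable fun x : ℝ≥0∞ => expNeg (y.1 * x)).aestronglyMeasurable)]
  refine Finset.prod_congr rfl fun y _ => ?_
  have hy : y.1 ≠ 0 := by
    have h2 : y.1 ∈ f.range.filter (· ≠ 0) := hS.subst (motive := fun T => y.1 ∈ T) y.2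
    exact (Finset.mem_filter.1 h2).2
  exact h.integral_expNeg_mul_count (f.measurableSet_preimage _)
    (hfin _ hy) y.1

/-- The Laplace functional of a Poisson point process. -/
theorem laplace [IsProbabilityMeasure μ] [SigmaFinite Λ] (h : IsPoissonPointProcess μ Φ Λ)
    {f : E → ℝ≥0∞} (hf : Measurable f) :
    ∫ ω, expNeg (∫⁻ x, f x ∂(Φ ω)) ∂μ =
      expNeg (∫⁻ x, ENNReal.ofReal (1 - expNeg (f x)) ∂Λ) := by
  classical
  -- Restricting the approximating simple functions to sets of finite intensity gives their nonzero
  -- level sets finite intensity.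
  let S : ℕ → Set E := spanningSets Λ
  have hS : ∀ n, MeasurableSet (S n) := measurableSet_spanningSets Λ
  let g : ℕ → SimpleFunc E ℝ≥0 := fun n =>
    ((SimpleFunc.eapprox f n).map ENNReal.toNNReal).restrict (S n)
  have hg : ∀ n x, (g n x : ℝ≥0∞) = (S n).indicator (fun x => SimpleFunc.eapprox f n x) x := by
    intro n x
    simp only [g, SimpleFunc.restrict_apply _ (hS n)]
    by_cases hx : x ∈ S n
    · simp [hx, ENNReal.coe_toNNReal (SimpleFunc.eapprox_lt_top f n x).ne]
    · simp [hx]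
  have hmono : ∀ x, Monotone fun n => (g n x : ℝ≥0∞) := by
    intro x m n hmn
    simp only [hg]
    by_cases hx : x ∈ S m
    · rw [Set.indicator_of_mem hx, Set.indicator_of_mem (monotone_spanningSets Λ hmn hx)]
      exact SimpleFunc.monotone_eapprox f hmn x
    · rw [Set.indicator_of_notMem hx]; exact zero_le
  have hlim : ∀ x, Tendsto (fun n => (g n x : ℝ≥0∞)) atTop (𝓝 (f x)) := by
    intro x
    have h1 : Tendsto (fun n => SimpleFunc.eapprox f n x) atTop (𝓝 (f x)) := by
      have := tendsto_atTop_iSup (fun m n hmn => SimpleFunc.monotone_eapprox f hmn x)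
      rwa [SimpleFunc.iSup_eapprox_apply hf x] at this
    refine h1.congr' ?_
    obtain ⟨N, hN⟩ : ∃ N, x ∈ S N := by
      have : x ∈ ⋃ i, S i := by simp [S, iUnion_spanningSets]
      simpa using this
    filter_upwards [eventually_ge_atTop N] with n hn
    rw [hg, Set.indicator_of_mem (monotone_spanningSets Λ hn hN)]
  have hmeas : ∀ n, Measurable fun x => (g n x : ℝ≥0∞) := fun n =>
    (g n).measurable.coe_nnreal_ennreal
  have hint : ∀ n, ∫ ω, expNeg (∫⁻ x, g n x ∂(Φ ω)) ∂μ =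
      expNeg (∫⁻ x, ENNReal.ofReal (1 - expNeg (g n x)) ∂Λ) := by
    intro n
    refine h.laplace_simpleFunc (g n) fun y hy => ?_
    refine lt_of_le_of_lt (measure_mono ?_) (measure_spanningSets_lt_top Λ n)
    intro x hx
    by_contra hxs
    apply hy
    have h0 : (g n x : ℝ≥0∞) = 0 := by rw [hg, Set.indicator_of_notMem hxs]
    rw [← show g n x = y from hx]
    exact_mod_cast h0
  have hL : Tendsto (fun n => ∫ ω, expNeg (∫⁻ x, g n x ∂(Φ ω)) ∂μ) atTop
      (𝓝 (∫ ω, expNeg (∫⁻ x, f x ∂(Φ ω)) ∂μ)) := by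
    refine tendsto_integral_expNeg (fun n => (h.measurable_lintegral (hmeas n)).aemeasurable) ?_
    refine ae_of_all _ fun ω => ?_
    exact lintegral_tendsto_of_tendsto_of_monotone (fun n => (hmeas n).aemeasurable)
      (ae_of_all _ hmono) (ae_of_all _ hlim)
  have hanti : Antitone expNeg := by
    intro x y hxy
    obtain ⟨z, rfl⟩ := exists_add_of_le hxy
    rw [expNeg_add]
    exact mul_le_of_le_one_right (expNeg_nonneg x) (expNeg_le_one z)
  have hR : Tendsto (fun n => expNeg (∫⁻ x, ENNReal.ofReal (1 - expNeg (g n x)) ∂Λ)) atTop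
      (𝓝 (expNeg (∫⁻ x, ENNReal.ofReal (1 - expNeg (f x)) ∂Λ))) := by
    refine (continuous_expNeg.tendsto _).comp ?_
    refine lintegral_tendsto_of_tendsto_of_monotone (fun n => ?_)
      (ae_of_all _ fun x m n hmn => ?_) (ae_of_all _ fun x => ?_)
    · have := hmeas n
      fun_prop
    · exact ENNReal.ofReal_le_ofReal (sub_le_sub_left (hanti (hmono x hmn)) _)
    · exact (ENNReal.continuous_ofReal.tendsto _).comp
        (((continuous_expNeg.tendsto _).comp (hlim x)).const_sub 1)
  simp_rw [hint] at hL
  exact tendsto_nhds_unique hL hR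

end IsPoissonPointProcess

/-! ### Conditioning a ranked Poisson point process on its nearest point -/

/-- The integrals may be infinite and `u` need not be monotone, so neither dominated nor monotone
convergence applies. Fatou gives the lower bound, inclusion of the domains the upper one. -/
theorem tendsto_setLIntegral_norm_ge {E : Type*} [NormedAddCommGroup E] [MeasurableSpace E]
    [BorelSpace E] (Λ : Measure E) {g : E → ℝ≥0∞} (hg : Measurable g) {u : ℕ → ℝ} {r : ℝ}
    (hu : ∀ m, r < u m) (hlim : Tendsto u atTop (𝓝 r)) :
    Tendsto (fun m => ∫⁻ x in {x | u m ≤ ‖x‖}, g x ∂Λ) atTop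
      (𝓝 (∫⁻ x in {x | r < ‖x‖}, g x ∂Λ)) := by
  have hm1 : ∀ m, MeasurableSet {x : E | u m ≤ ‖x‖} := fun m =>
    measurableSet_le measurable_const measurable_norm
  have hm2 : MeasurableSet {x : E | r < ‖x‖} := measurableSet_lt measurable_const measurable_norm
  refine tendsto_of_le_liminf_of_limsup_le ?_ ?_
  · simp_rw [← lintegral_indicator (hm1 _), ← lintegral_indicator hm2]
    refine le_trans (lintegral_mono fun x => ?_)
      (lintegral_liminf_le fun m => hg.indicator (hm1 m))
    by_cases hx : r < ‖x‖
    · have h1 : Tendsto (fun m => ({x : E | u m ≤ ‖x‖}).indicator g x) atTop (𝓝 (g x)) := by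
        refine tendsto_const_nhds.congr' ?_
        filter_upwards [hlim.eventually (gt_mem_nhds hx)] with m hmx
        rw [Set.indicator_of_mem]
        exact hmx.le
      rw [h1.liminf_eq]
      exact Set.indicator_le_self _ _ _
    · rw [Set.indicator_of_notMem (by simpa using hx)]
      exact zero_le
  · refine (limsup_le_of_le (h := Eventually.of_forall fun m => ?_))
    exact lintegral_mono_set fun x hx => lt_of_lt_of_le (hu m) hx

namespace IsPoissonPointProcess

variable {Ω E : Type*} [MeasurableSpace Ω] [NormedAddCommGroup E] [MeasurableSpace E]
  [BorelSpace E] {μ : Measure Ω} [IsProbabilityMeasure μ] {v : ℕ → Ω → E} {Λ : Measure E}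

/-- A test function equal to `∞` on the ball of radius `t'` encodes the event that the ball is
empty, which is `t' ≤ ‖v 0‖` because the points are ranked. Since `t' ≤ t`, it and the truncated `f`
have disjoint supports, so the exponent of the Laplace functional splits. -/
theorem setIntegral_nearest_ge [SigmaFinite Λ] (hv : ∀ n, Measurable (v n))
    (hr : ∀ᵐ ω ∂μ, StrictMono fun n => ‖v n ω‖)
    (h : IsPoissonPointProcess μ (fun ω => Measure.sum fun n => Measure.dirac (v n ω)) Λ)
    {f : E → ℝ≥0∞} (hf : Measurable f) {t' t : ℝ} (htt : t' ≤ t) :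
    ∫ ω in {ω | t' ≤ ‖v 0 ω‖}, expNeg (∑' n, {x | t ≤ ‖x‖}.indicator f (v n ω)) ∂μ =
      expNeg (Λ {x | ‖x‖ < t'}) *
        expNeg (∫⁻ x in {x | t ≤ ‖x‖}, ENNReal.ofReal (1 - expNeg (f x)) ∂Λ) := by
  have hB : MeasurableSet {x : E | ‖x‖ < t'} := measurableSet_lt measurable_norm measurable_const
  have hT : MeasurableSet {x : E | t ≤ ‖x‖} := measurableSet_le measurable_const measurable_norm
  have hF1 : Measurable ({x : E | ‖x‖ < t'}.indicator fun _ => ∞) :=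
    measurable_const.indicator hB
  have hF2 : Measurable ({x : E | t ≤ ‖x‖}.indicator f) := hf.indicator hT
  have key := h.laplace (hF1.add hF2)
  have e1 : ∀ ω, ∫⁻ x, ({x : E | ‖x‖ < t'}.indicator (fun _ => ∞) +
        {x : E | t ≤ ‖x‖}.indicator f) x ∂(Measure.sum fun n => Measure.dirac (v n ω)) =
      (∑' n, {x : E | ‖x‖ < t'}.indicator (fun _ => ∞) (v n ω)) +
        ∑' n, {x | t ≤ ‖x‖}.indicator f (v n ω) := by
    intro ω
    rw [lintegral_sum_measure, ← ENNReal.tsum_add]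
    exact tsum_congr fun n => by rw [lintegral_dirac' _ (hF1.add hF2)]; rfl
  have e2 : ∫⁻ x, ENNReal.ofReal (1 - expNeg (({x : E | ‖x‖ < t'}.indicator (fun _ => ∞) +
        {x : E | t ≤ ‖x‖}.indicator f) x)) ∂Λ = Λ {x | ‖x‖ < t'} +
        ∫⁻ x in {x | t ≤ ‖x‖}, ENNReal.ofReal (1 - expNeg (f x)) ∂Λ := by
    rw [← lintegral_indicator_one hB, ← lintegral_indicator hT,
      ← lintegral_add_left (measurable_one.indicator hB)]
    refine lintegral_congr fun x => ?_
    by_cases hx : ‖x‖ < t'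
    · have hx2 : ¬ t ≤ ‖x‖ := by linarith
      simp [Set.indicator, hx, hx2]
    · by_cases hx2 : t ≤ ‖x‖ <;> simp [Set.indicator, hx, hx2]
  rw [e2, expNeg_add] at key
  rw [← key, ← integral_indicator (measurableSet_le measurable_const (hv 0).norm)]
  refine integral_congr_ae ?_
  filter_upwards [hr] with ω hω
  simp only [e1, expNeg_add]
  by_cases h0 : t' ≤ ‖v 0 ω‖
  · rw [Set.indicator_of_mem (by exact h0)]
    have : ∀ n, {x : E | ‖x‖ < t'}.indicator (fun _ => ∞) (v n ω) = (0 : ℝ≥0∞) := by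
      intro n
      rw [Set.indicator_of_notMem]
      have := hω.monotone (Nat.zero_le n)
      simp only [Set.mem_ofPred_eq, not_lt] at this ⊢
      linarith
    simp [this]
  · rw [Set.indicator_of_notMem (by exact h0)]
    have : ∑' n, {x : E | ‖x‖ < t'}.indicator (fun _ => ∞) (v n ω) = (∞ : ℝ≥0∞) := by
      refine ENNReal.tsum_eq_top_of_eq_top ⟨0, ?_⟩
      rw [Set.indicator_of_mem]
      simpa using h0
    simp [this]

/-- This is the difference of two instances of `setIntegral_nearest_ge`, at `t'` and at `t`. The
factor coming from `f` is common to both, and the other factors are the probabilities that `‖v 0‖`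
exceeds `t'` or `t`. -/
theorem setIntegral_nearest_Ico [SigmaFinite Λ] (hv : ∀ n, Measurable (v n))
    (hr : ∀ᵐ ω ∂μ, StrictMono fun n => ‖v n ω‖)
    (h : IsPoissonPointProcess μ (fun ω => Measure.sum fun n => Measure.dirac (v n ω)) Λ)
    {f : E → ℝ≥0∞} (hf : Measurable f) {t' t : ℝ} (htt : t' ≤ t) :
    ∫ ω in {ω | ‖v 0 ω‖ ∈ Set.Ico t' t}, expNeg (∑' n, {x | t ≤ ‖x‖}.indicator f (v n ω)) ∂μ =
      ∫ _ω in {ω | ‖v 0 ω‖ ∈ Set.Ico t' t},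
        expNeg (∫⁻ x in {x | t ≤ ‖x‖}, ENNReal.ofReal (1 - expNeg (f x)) ∂Λ) ∂μ := by
  have hms : ∀ t : ℝ, MeasurableSet {ω | t ≤ ‖v 0 ω‖} := fun t =>
    measurableSet_le measurable_const (hv 0).norm
  have hset : {ω | ‖v 0 ω‖ ∈ Set.Ico t' t} = {ω | t' ≤ ‖v 0 ω‖} \ {ω | t ≤ ‖v 0 ω‖} := by
    ext ω; simp
  have hsub : {ω | t ≤ ‖v 0 ω‖} ⊆ {ω | t' ≤ ‖v 0 ω‖} := fun ω hω => le_trans htt hω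
  have hT : MeasurableSet {x : E | t ≤ ‖x‖} := measurableSet_le measurable_const measurable_norm
  have hX : Measurable fun ω => ∑' n, {x | t ≤ ‖x‖}.indicator f (v n ω) :=
    Measurable.tsum fun n => (hf.indicator hT).comp (hv n)
  have h0 : ∀ s ≤ t, μ.real {ω | s ≤ ‖v 0 ω‖} = expNeg (Λ {x | ‖x‖ < s}) := by
    intro s hs
    have := h.setIntegral_nearest_ge hv hr (f := fun _ => 0) measurable_const hs
    simpa using this
  rw [hset, setIntegral_sdiff (hms t) (integrable_expNeg hX.aemeasurable).integrableOn hsub,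
    h.setIntegral_nearest_ge hv hr hf htt, h.setIntegral_nearest_ge hv hr hf le_rfl,
    setIntegral_const, measureReal_sdiff hsub (hms t), h0 t' htt, h0 t le_rfl, smul_eq_mul]
  ring

/-- The threshold is the right end of the mesh cell containing `‖v 0‖`. It is constant on each cell,
so `setIntegral_nearest_Ico` applies cell by cell. -/
theorem setIntegral_nearest_mesh [SigmaFinite Λ] (hv : ∀ n, Measurable (v n))
    (hr : ∀ᵐ ω ∂μ, StrictMono fun n => ‖v n ω‖)
    (h : IsPoissonPointProcess μ (fun ω => Measure.sum fun n => Measure.dirac (v n ω)) Λ)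
    {f : E → ℝ≥0∞} (hf : Measurable f) (a : ℝ) {δ : ℝ} (hδ : 0 < δ) (k : ℕ) :
    ∫ ω in {ω | ‖v 0 ω‖ ∈ Set.Ico a (a + k * δ)},
        expNeg (∑' n, {x | a + (⌊(‖v 0 ω‖ - a) / δ⌋₊ + 1) * δ ≤ ‖x‖}.indicator f (v n ω)) ∂μ =
      ∫ ω in {ω | ‖v 0 ω‖ ∈ Set.Ico a (a + k * δ)},
        expNeg (∫⁻ x in {x | a + (⌊(‖v 0 ω‖ - a) / δ⌋₊ + 1) * δ ≤ ‖x‖},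
          ENNReal.ofReal (1 - expNeg (f x)) ∂Λ) ∂μ := by
  have hu : Measurable fun ω => a + ((⌊(‖v 0 ω‖ - a) / δ⌋₊ : ℝ) + 1) * δ := by
    have := (hv 0).norm
    have h2 : Measurable fun ω => (⌊(‖v 0 ω‖ - a) / δ⌋₊ : ℝ) :=
      (measurable_from_nat (f := fun n : ℕ => (n : ℝ))).comp
        (Nat.measurable_floor.comp ((this.sub_const a).div_const δ))
    fun_prop
  have hX : Measurable fun ω =>
      ∑' n, {x | a + (⌊(‖v 0 ω‖ - a) / δ⌋₊ + 1) * δ ≤ ‖x‖}.indicator f (v n ω) := by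
    refine Measurable.tsum fun n => ?_
    have : (fun ω => {x | a + ((⌊(‖v 0 ω‖ - a) / δ⌋₊ : ℝ) + 1) * δ ≤ ‖x‖}.indicator f (v n ω)) =
        {ω | a + ((⌊(‖v 0 ω‖ - a) / δ⌋₊ : ℝ) + 1) * δ ≤ ‖v n ω‖}.indicator
          fun ω => f (v n ω) := by
      ext ω; simp [Set.indicator]
    rw [this]
    exact (hf.comp (hv n)).indicator (measurableSet_le hu (hv n).norm)
  have hH : Measurable fun ω => ∫⁻ x in {x | a + (⌊(‖v 0 ω‖ - a) / δ⌋₊ + 1) * δ ≤ ‖x‖},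
      ENNReal.ofReal (1 - expNeg (f x)) ∂Λ := by
    have hanti : Antitone fun t : ℝ =>
        ∫⁻ x in {x : E | t ≤ ‖x‖}, ENNReal.ofReal (1 - expNeg (f x)) ∂Λ :=
      fun s t hst => lintegral_mono_set fun x hx => le_trans hst hx
    exact hanti.measurable.comp hu
  have hms : ∀ s t : ℝ, MeasurableSet {ω | ‖v 0 ω‖ ∈ Set.Ico s t} := fun s t =>
    (hv 0).norm measurableSet_Ico
  induction k with
  | zero => simp
  | succ k ih =>
    have hle : a + (k : ℝ) * δ ≤ a + ((k + 1 : ℕ) : ℝ) * δ := by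
      push_cast; nlinarith
    have hle0 : a ≤ a + (k : ℝ) * δ := by
      have : 0 ≤ (k : ℝ) * δ := by positivity
      linarith
    have hset : {ω | ‖v 0 ω‖ ∈ Set.Ico a (a + (k + 1 : ℕ) * δ)} =
        {ω | ‖v 0 ω‖ ∈ Set.Ico a (a + k * δ)} ∪
          {ω | ‖v 0 ω‖ ∈ Set.Ico (a + k * δ) (a + (k + 1 : ℕ) * δ)} := by
      rw [← Set.Ico_union_Ico_eq_Ico hle0 hle]; rfl
    have hdisj : Disjoint {ω | ‖v 0 ω‖ ∈ Set.Ico a (a + k * δ)}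
        {ω | ‖v 0 ω‖ ∈ Set.Ico (a + k * δ) (a + (k + 1 : ℕ) * δ)} :=
      Set.disjoint_left.2 fun ω h1 h2 => absurd h2.1 (not_le.2 h1.2)
    have hcell : ∀ ω ∈ {ω | ‖v 0 ω‖ ∈ Set.Ico (a + k * δ) (a + (k + 1 : ℕ) * δ)},
        a + ((⌊(‖v 0 ω‖ - a) / δ⌋₊ : ℝ) + 1) * δ = a + (k + 1 : ℕ) * δ := by
      intro ω hω
      have : ⌊(‖v 0 ω‖ - a) / δ⌋₊ = k := by
        have h1 := hω.1
        have h2 := hω.2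
        push_cast at h2
        refine (Nat.floor_eq_iff (div_nonneg (by linarith) hδ.le)).2 ⟨?_, ?_⟩
        · rw [le_div_iff₀ hδ]; linarith
        · rw [div_lt_iff₀ hδ]; linarith
      rw [this]; push_cast; rfl
    rw [hset, setIntegral_union hdisj (hms _ _) (integrable_expNeg hX.aemeasurable).integrableOn
        (integrable_expNeg hX.aemeasurable).integrableOn,
      setIntegral_union hdisj (hms _ _) (integrable_expNeg hH.aemeasurable).integrableOn
        (integrable_expNeg hH.aemeasurable).integrableOn, ih]
    congr 1
    rw [setIntegral_congr_fun (hms _ _) fun _ hω => by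
        simp only [hcell _ hω]; rfl, h.setIntegral_nearest_Ico hv hr hf hle]
    exact setIntegral_congr_fun (hms _ _) fun _ hω => by
      simp only [hcell _ hω]

theorem setIntegral_expNeg_nearest_Ico [SigmaFinite Λ] (hv : ∀ n, Measurable (v n))
    (hr : ∀ᵐ ω ∂μ, StrictMono fun n => ‖v n ω‖)
    (h : IsPoissonPointProcess μ (fun ω => Measure.sum fun n => Measure.dirac (v n ω)) Λ)
    {f : E → ℝ≥0∞} (hf : Measurable f) {a b : ℝ} (hab : a < b) :
    ∫ ω in {ω | ‖v 0 ω‖ ∈ Set.Ico a b}, expNeg (∑' n, f (v (n + 1) ω)) ∂μ =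
      ∫ ω in {ω | ‖v 0 ω‖ ∈ Set.Ico a b}, expNeg (∫⁻ x in {x | ‖v 0 ω‖ < ‖x‖},
        ENNReal.ofReal (1 - expNeg (f x)) ∂Λ) ∂μ := by
  have hg : Measurable fun x => ENNReal.ofReal (1 - expNeg (f x)) := by fun_prop
  have hδ : ∀ m : ℕ, 0 < (b - a) / (m + 1 : ℕ) := fun m => by
    have : 0 < b - a := by linarith
    positivity
  have hδlim : Tendsto (fun m : ℕ => (b - a) / (m + 1 : ℕ)) atTop (𝓝 0) :=
    (tendsto_const_div_atTop_nhds_zero_nat (b - a)).comp (tendsto_add_atTop_nat 1)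
  have hms : MeasurableSet {ω | ‖v 0 ω‖ ∈ Set.Ico a b} := (hv 0).norm measurableSet_Ico
  -- `u m r` is the right end of the cell containing `r` in the mesh of `m + 1` equal cells on `[a,
  -- b)`. It lies strictly above `r` and tends to `r`.
  obtain ⟨u, hu⟩ : ∃ u : ℕ → ℝ → ℝ, u = fun m r =>
    a + ((⌊(r - a) / ((b - a) / (m + 1 : ℕ))⌋₊ : ℝ) + 1) * ((b - a) / (m + 1 : ℕ)) := ⟨_, rfl⟩
  have hum : ∀ m, Measurable (u m) := by
    intro m
    have h2 : Measurable fun r : ℝ => (⌊(r - a) / ((b - a) / (m + 1 : ℕ))⌋₊ : ℝ) :=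
      (measurable_from_nat (f := fun n : ℕ => (n : ℝ))).comp
        (Nat.measurable_floor.comp ((measurable_id.sub_const a).div_const _))
    rw [hu]; fun_prop
  have hu1 : ∀ m r, r < u m r := by
    intro m r
    have := Nat.lt_floor_add_one ((r - a) / ((b - a) / (m + 1 : ℕ)))
    rw [div_lt_iff₀ (hδ m)] at this
    rw [hu]
    dsimp only
    linarith
  have hu2 : ∀ m r, a ≤ r → u m r ≤ r + (b - a) / (m + 1 : ℕ) := by
    intro m r har
    have := Nat.floor_le (div_nonneg (sub_nonneg.2 har) (hδ m).le)
    rw [le_div_iff₀ (hδ m)] at this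
    rw [hu]
    dsimp only
    linarith
  have hulim : ∀ r, a ≤ r → Tendsto (fun m => u m r) atTop (𝓝 r) := by
    intro r har
    refine tendsto_of_tendsto_of_tendsto_of_le_of_le tendsto_const_nhds
      (by simpa using hδlim.const_add r) (fun m => (hu1 m r).le) (fun m => hu2 m r har)
  have hmesh : ∀ m : ℕ, ∫ ω in {ω | ‖v 0 ω‖ ∈ Set.Ico a b},
        expNeg (∑' n, {x | u m ‖v 0 ω‖ ≤ ‖x‖}.indicator f (v n ω)) ∂μ =
      ∫ ω in {ω | ‖v 0 ω‖ ∈ Set.Ico a b}, expNeg (∫⁻ x in {x | u m ‖v 0 ω‖ ≤ ‖x‖},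
        ENNReal.ofReal (1 - expNeg (f x)) ∂Λ) ∂μ := by
    intro m
    have := h.setIntegral_nearest_mesh hv hr hf a (hδ m) (m + 1)
    rw [mul_div_cancel₀ _ (by positivity), add_sub_cancel] at this
    rw [hu]; exact this
  have hL : Tendsto (fun m => ∫ ω in {ω | ‖v 0 ω‖ ∈ Set.Ico a b},
      expNeg (∑' n, {x | u m ‖v 0 ω‖ ≤ ‖x‖}.indicator f (v n ω)) ∂μ) atTop
      (𝓝 (∫ ω in {ω | ‖v 0 ω‖ ∈ Set.Ico a b}, expNeg (∑' n, f (v (n + 1) ω)) ∂μ)) := by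
    refine tendsto_integral_expNeg (fun m => ?_) ?_
    · refine (Measurable.tsum fun n => ?_).aemeasurable
      have : (fun ω => {x | u m ‖v 0 ω‖ ≤ ‖x‖}.indicator f (v n ω)) =
          {ω | u m ‖v 0 ω‖ ≤ ‖v n ω‖}.indicator fun ω => f (v n ω) := by
        ext ω; simp [Set.indicator]
      rw [this]
      exact (hf.comp (hv n)).indicator
        (measurableSet_le ((hum m).comp (hv 0).norm) (hv n).norm)
    -- The threshold always excludes `v 0`. Once it falls below `‖v 1‖`, which strict ranking
    -- guarantees eventually, it keeps all the other points, and the truncated sum equals the full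
    -- one.
    · filter_upwards [ae_restrict_of_ae hr, ae_restrict_mem hms] with ω hω hωI
      refine tendsto_const_nhds.congr' ?_
      have h01 : ‖v 0 ω‖ < ‖v 1 ω‖ := hω Nat.zero_lt_one
      filter_upwards [(hulim _ hωI.1).eventually (gt_mem_nhds h01)] with m hm
      symm
      have hout : v 0 ω ∉ {x | u m ‖v 0 ω‖ ≤ ‖x‖} := by simpa using hu1 m ‖v 0 ω‖
      rw [tsum_eq_zero_add' ENNReal.summable, Set.indicator_of_notMem hout, zero_add]
      refine tsum_congr fun n => ?_
      rw [Set.indicator_of_mem]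
      exact le_trans hm.le (hω.monotone (Nat.succ_le_succ (Nat.zero_le n)))
  have hR : Tendsto (fun m => ∫ ω in {ω | ‖v 0 ω‖ ∈ Set.Ico a b},
      expNeg (∫⁻ x in {x | u m ‖v 0 ω‖ ≤ ‖x‖}, ENNReal.ofReal (1 - expNeg (f x)) ∂Λ) ∂μ) atTop
      (𝓝 (∫ ω in {ω | ‖v 0 ω‖ ∈ Set.Ico a b}, expNeg (∫⁻ x in {x | ‖v 0 ω‖ < ‖x‖},
        ENNReal.ofReal (1 - expNeg (f x)) ∂Λ) ∂μ)) := by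
    refine tendsto_integral_expNeg (fun m => ?_) ?_
    · have hanti : Antitone fun t : ℝ =>
          ∫⁻ x in {x : E | t ≤ ‖x‖}, ENNReal.ofReal (1 - expNeg (f x)) ∂Λ :=
        fun s t hst => lintegral_mono_set fun x hx => le_trans hst hx
      exact (hanti.measurable.comp ((hum m).comp (hv 0).norm)).aemeasurable
    · filter_upwards [ae_restrict_mem hms] with ω hωI
      exact tendsto_setLIntegral_norm_ge Λ hg (fun m => hu1 m _) (hulim _ hωI.1)
  simp_rw [hmesh] at hL
  exact tendsto_nhds_unique hL hR

/-- Given the nearest point, the others form a Poisson point process outside the ball. -/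
theorem setIntegral_expNeg_nearest [SigmaFinite Λ] (hv : ∀ n, Measurable (v n))
    (hr : ∀ᵐ ω ∂μ, StrictMono fun n => ‖v n ω‖)
    (h : IsPoissonPointProcess μ (fun ω => Measure.sum fun n => Measure.dirac (v n ω)) Λ)
    {f : E → ℝ≥0∞} (hf : Measurable f) {A : Set ℝ} (hA : MeasurableSet A) :
    ∫ ω in {ω | ‖v 0 ω‖ ∈ A}, expNeg (∑' n, f (v (n + 1) ω)) ∂μ =
      ∫ ω in {ω | ‖v 0 ω‖ ∈ A}, expNeg (∫⁻ x in {x | ‖v 0 ω‖ < ‖x‖},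
        ENNReal.ofReal (1 - expNeg (f x)) ∂Λ) ∂μ := by
  have hX : Measurable fun ω => ∑' n, f (v (n + 1) ω) :=
    Measurable.tsum fun n => hf.comp (hv (n + 1))
  have hHa : Antitone fun t : ℝ =>
      ∫⁻ x in {x : E | t < ‖x‖}, ENNReal.ofReal (1 - expNeg (f x)) ∂Λ :=
    fun s t hst => lintegral_mono_set fun x hx => lt_of_le_of_lt hst hx
  have hH : Measurable fun ω => ∫⁻ x in {x : E | ‖v 0 ω‖ < ‖x‖},
      ENNReal.ofReal (1 - expNeg (f x)) ∂Λ := hHa.measurable.comp (hv 0).norm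
  -- The law of `‖v 0‖` weighted by `expNeg Y` is a finite measure on the line, so agreement on the
  -- intervals `[a, b)` extends to all Borel sets.
  let ν : (Ω → ℝ≥0∞) → Measure ℝ := fun Y =>
    (μ.withDensity fun ω => ENNReal.ofReal (expNeg (Y ω))).map fun ω => ‖v 0 ω‖
  have hν : ∀ {Y : Ω → ℝ≥0∞} (_ : Measurable Y) {B : Set ℝ} (_ : MeasurableSet B),
      ν Y B = ENNReal.ofReal (∫ ω in {ω | ‖v 0 ω‖ ∈ B}, expNeg (Y ω) ∂μ) := by
    intro Y hY B hB
    simp only [ν]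
    rw [Measure.map_apply (hv 0).norm hB, withDensity_apply _ ((hv 0).norm hB),
      ofReal_integral_eq_lintegral_ofReal (integrable_expNeg hY.aemeasurable).integrableOn
        (ae_of_all _ fun _ => expNeg_nonneg _)]
    rfl
  have hfin : ∀ {Y : Ω → ℝ≥0∞} (_ : Measurable Y), IsFiniteMeasure (ν Y) := fun hY =>
    ⟨by rw [hν hY MeasurableSet.univ]; exact ENNReal.ofReal_lt_top⟩
  have := hfin hX
  have hEq : (ν fun ω => ∑' n, f (v (n + 1) ω)) = ν fun ω => ∫⁻ x in {x | ‖v 0 ω‖ < ‖x‖},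
      ENNReal.ofReal (1 - expNeg (f x)) ∂Λ := Measure.ext_of_Ico _ _ fun a b hab => by
    rw [hν hX measurableSet_Ico, hν hH measurableSet_Ico, h.setIntegral_expNeg_nearest_Ico hv hr hf hab]
  have h2 := congrArg (fun ν => ν A) hEq
  simp only [hν hX hA, hν hH hA] at h2
  exact (ENNReal.ofReal_eq_ofReal_iff (integral_nonneg fun _ => expNeg_nonneg _)
    (integral_nonneg fun _ => expNeg_nonneg _)).1 h2

end IsPoissonPointProcess

/-! ### The marks of the interferers -/

instance : DiscreteMeasurableSpace Link := ⟨fun _ => trivial⟩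

instance : DecidableEq Link := fun a b => by
  cases a <;> cases b <;> first | exact isTrue rfl | exact isFalse (by simp)

instance : Fintype Link := ⟨{Link.L, Link.N}, fun κ => by cases κ <;> simp⟩

theorem Link.sum_univ {M : Type*} [AddCommMonoid M] (f : Link → M) :
    ∑ κ, f κ = f Link.L + f Link.N := by
  have : (Finset.univ : Finset Link) = {Link.L, Link.N} := rfl
  rw [this, Finset.sum_pair (by simp)]

/-- The Laplace transform of a normalized Gamma variable. -/
theorem lintegral_gammaMeasure_expNeg {N : ℕ} (hN : 1 ≤ N) {s b : ℝ} (hs : 0 ≤ s) (hb : 0 ≤ b) :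
    ∫⁻ y, ENNReal.ofReal (expNeg (ENNReal.ofReal s * ENNReal.ofReal (b * y)))
      ∂(gammaMeasure N N) = ENNReal.ofReal ((1 + s * b / N) ^ N)⁻¹ := by
  have hN0 : (0 : ℝ) < N := by exact_mod_cast hN
  have hsb : 0 ≤ s * b := mul_nonneg hs hb
  -- Exponential tilting: the weight `exp (-s b y)` changes the rate `N` to `N + s b`, and the ratio
  -- of the normalizations is the asserted transform.
  have hpt : ∀ y, gammaPDF N N y *
      ENNReal.ofReal (expNeg (ENNReal.ofReal s * ENNReal.ofReal (b * y))) =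
      ENNReal.ofReal ((1 + s * b / N) ^ N)⁻¹ * gammaPDF N (N + s * b) y := by
    intro y
    rcases lt_or_ge y 0 with hy | hy
    · simp [gammaPDF_of_neg hy]
    · rw [gammaPDF_of_nonneg hy, gammaPDF_of_nonneg hy, ← ENNReal.ofReal_mul hs,
        expNeg_ofReal (by positivity), ← ENNReal.ofReal_mul (by positivity),
        ← ENNReal.ofReal_mul (by positivity)]
      congr 1
      have h1 : (1 + s * b / N : ℝ) = (N + s * b) / N := by field_simp
      rw [h1, div_pow, inv_div, Real.rpow_natCast, Real.rpow_natCast]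
      have h2 : Real.exp (-(((N : ℝ) + s * b) * y)) =
          Real.exp (-(N * y)) * Real.exp (-(s * (b * y))) := by
        rw [← Real.exp_add]; ring_nf
      rw [h2]
      have : ((N : ℝ) + s * b) ^ N ≠ 0 := by positivity
      field_simp
  have hm : ∀ a r : ℝ, Measurable (gammaPDF a r) := fun a r =>
    (measurable_gammaPDFReal a r).ennreal_ofReal
  rw [gammaMeasure, lintegral_withDensity_eq_lintegral_mul _
    (hm _ _) (by fun_prop)]
  simp only [Pi.mul_apply]
  simp_rw [hpt]
  rw [lintegral_const_mul _ (hm _ _),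
    lintegral_gammaPDF_eq_one hN0 (by positivity), mul_one]

theorem lintegral_pi_prod {ι : Type*} [Fintype ι] {X : ι → Type*} [∀ i, MeasurableSpace (X i)]
    (ν : ∀ i, Measure (X i)) [∀ i, IsProbabilityMeasure (ν i)] {f : ∀ i, X i → ℝ≥0∞}
    (hf : ∀ i, Measurable (f i)) :
    ∫⁻ x, ∏ i, f i (x i) ∂(Measure.pi ν) = ∏ i, ∫⁻ y, f i y ∂(ν i) := by
  have hind : iIndepFun (fun i (x : ∀ i, X i) => f i (x i)) (Measure.pi ν) :=
    iIndepFun_pi (fun i => (hf i).aemeasurable)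
  rw [lintegral_prod_eq_prod_lintegral_of_indepFun _ _ hind
    (fun i => (hf i).comp (measurable_pi_apply i))]
  refine Finset.prod_congr rfl fun i _ => ?_
  exact (measurePreserving_eval ν i).lintegral_comp (hf i)

/-! ### State and gain probabilities, and the transform of a single interferer. -/

namespace DownlinkParams

variable {P : DownlinkParams}

theorem losProb_nonneg (P : DownlinkParams) (k : ℕ) : 0 ≤ P.losProb k := by
  unfold losProb
  split_ifs
  · exact zero_le_one
  · refine Finset.prod_nonneg fun n _ => ?_
    rw [sub_nonneg, Real.exp_le_one_iff, neg_nonpos]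
    positivity

theorem losProb_le_one (P : DownlinkParams) (k : ℕ) : P.losProb k ≤ 1 := by
  unfold losProb
  split_ifs
  · exact le_rfl
  · refine Finset.prod_le_one (fun n _ => ?_) fun n _ => ?_
    · rw [sub_nonneg, Real.exp_le_one_iff, neg_nonpos]
      positivity
    · rw [sub_le_self_iff]; positivity

theorem linkProb_nonneg (P : DownlinkParams) (κ : Link) (k : ℕ) : 0 ≤ P.linkProb κ k := by
  cases κ
  · exact P.losProb_nonneg k
  · exact sub_nonneg.2 (P.losProb_le_one k)

theorem linkProb_le_one (P : DownlinkParams) (κ : Link) (k : ℕ) : P.linkProb κ k ≤ 1 := by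
  cases κ
  · exact P.losProb_le_one k
  · exact sub_le_self _ (P.losProb_nonneg k)

theorem sum_linkProb (P : DownlinkParams) (k : ℕ) : ∑ κ, P.linkProb κ k = 1 := by
  simp [Link.sum_univ, linkProb]

theorem beam_mem {x y : ℝ} (hx : x ∈ Set.Icc 0 (2 * Real.pi)) (hy : y ∈ Set.Icc 0 Real.pi) :
    x / (2 * Real.pi) * (y / Real.pi) ∈ Set.Icc (0 : ℝ) 1 := by
  have hpi := Real.pi_pos
  have h1 : x / (2 * Real.pi) ≤ 1 := (div_le_one (by positivity)).2 hx.2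
  have h2 : y / Real.pi ≤ 1 := (div_le_one hpi).2 hy.2
  have h3 : 0 ≤ x / (2 * Real.pi) := div_nonneg hx.1 (by positivity)
  have h4 : 0 ≤ y / Real.pi := div_nonneg hy.1 hpi.le
  exact ⟨mul_nonneg h3 h4, mul_le_one₀ h1 h4 h2⟩

theorem Admissible.gainProb_nonneg (hP : P.Admissible) (i : Fin 4) : 0 ≤ P.gainProb i := by
  have ht : P.qt ∈ Set.Icc (0 : ℝ) 1 := beam_mem hP.θta_mem hP.θte_mem
  have hr : P.qr ∈ Set.Icc (0 : ℝ) 1 := beam_mem hP.θra_mem hP.θre_mem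
  have h1 := ht.1
  have h2 := hr.1
  have h3 := sub_nonneg.2 ht.2
  have h4 := sub_nonneg.2 hr.2
  fin_cases i <;> simp [gainProb] <;> positivity

theorem sum_gainProb (P : DownlinkParams) : ∑ i, P.gainProb i = 1 := by
  simp only [gainProb, Fin.sum_univ_four]
  simp
  ring

theorem Admissible.gain_nonneg (hP : P.Admissible) (i : Fin 4) : 0 ≤ P.gain i := by
  have h1 := hP.Mt_nonneg
  have h2 := hP.Mr_nonneg
  have h3 := hP.mt_nonneg
  have h4 := hP.mr_nonneg
  fin_cases i <;> simp [gain] <;> positivity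

theorem Admissible.pathLoss_nonneg (hP : P.Admissible) (κ : Link) (r : ℝ) :
    0 ≤ P.pathLoss κ r :=
  div_nonneg (hP.C_pos κ).le (Real.sqrt_nonneg _)

@[fun_prop]
theorem measurable_pathLoss (P : DownlinkParams) (κ : Link) : Measurable (P.pathLoss κ) := by
  unfold pathLoss; fun_prop

theorem measurable_linkProb (P : DownlinkParams) (κ : Link) :
    Measurable fun r => P.linkProb κ (P.γ r) := by
  have h : Measurable P.γ := Nat.measurable_floor.comp (measurable_id.mul_const _)
  exact (measurable_from_nat (f := P.linkProb κ)).comp h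

noncomputable section

/-- The Laplace transform of the received power from an interferer at horizontal distance `r` in
the state `c.1` with gain pattern `c.2`. -/
def stateLaplace (P : DownlinkParams) (s : ℝ) (c : Link × Fin 4) (r : ℝ) : ℝ :=
  ((1 + s * (P.pathLoss c.1 r * P.gain c.2) / P.Nak c.1) ^ P.Nak c.1)⁻¹

/-- The Laplace transform of the received power from an interferer at horizontal distance `r`. -/
def markLaplace (P : DownlinkParams) (s r : ℝ) : ℝ :=
  ∑ c : Link × Fin 4, P.linkProb c.1 (P.γ r) * P.gainProb c.2 * P.stateLaplace s c r

end

theorem measurable_stateLaplace (P : DownlinkParams) (s : ℝ) (c : Link × Fin 4) :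
    Measurable (P.stateLaplace s c) := by
  unfold stateLaplace; fun_prop

theorem measurable_markLaplace (P : DownlinkParams) (s : ℝ) : Measurable (P.markLaplace s) := by
  unfold markLaplace
  exact Finset.measurable_sum _ fun c _ =>
    ((P.measurable_linkProb c.1).mul_const _).mul (P.measurable_stateLaplace s c)

theorem Admissible.stateLaplace_pos (hP : P.Admissible) {s : ℝ} (hs : 0 ≤ s)
    (c : Link × Fin 4) (r : ℝ) : 0 < P.stateLaplace s c r := by
  have h1 := hP.pathLoss_nonneg c.1 r
  have h2 := hP.gain_nonneg c.2
  unfold stateLaplace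
  positivity

theorem Admissible.stateLaplace_le_one (hP : P.Admissible) {s : ℝ} (hs : 0 ≤ s)
    (c : Link × Fin 4) (r : ℝ) : P.stateLaplace s c r ≤ 1 := by
  have h1 := hP.pathLoss_nonneg c.1 r
  have h2 := hP.gain_nonneg c.2
  refine inv_le_one_of_one_le₀ (one_le_pow₀ ?_)
  have : 0 ≤ s * (P.pathLoss c.1 r * P.gain c.2) / P.Nak c.1 := by positivity
  linarith

theorem sum_stateProb (P : DownlinkParams) (k : ℕ) :
    ∑ c : Link × Fin 4, P.linkProb c.1 k * P.gainProb c.2 = 1 := by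
  rw [Fintype.sum_prod_type]
  simp_rw [← Finset.mul_sum, P.sum_gainProb, mul_one, P.sum_linkProb]

theorem Admissible.stateProb_nonneg (hP : P.Admissible) (k : ℕ) (c : Link × Fin 4) :
    0 ≤ P.linkProb c.1 k * P.gainProb c.2 :=
  mul_nonneg (P.linkProb_nonneg _ _) (hP.gainProb_nonneg _)

/-- Since the probabilities sum to `1`, some pair of state and gain has positive probability. Strict
positivity is what allows `markLaplace` to be recovered from its logarithm. -/
theorem Admissible.markLaplace_pos (hP : P.Admissible) {s : ℝ} (hs : 0 ≤ s) (r : ℝ) :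
    0 < P.markLaplace s r := by
  obtain ⟨c, hc⟩ : ∃ c : Link × Fin 4, 0 < P.linkProb c.1 (P.γ r) * P.gainProb c.2 := by
    by_contra! hcon
    have h1 := P.sum_stateProb (P.γ r)
    have h2 := Finset.sum_nonpos fun (c : Link × Fin 4) (_ : c ∈ Finset.univ) => hcon c
    linarith
  exact Finset.sum_pos' (fun c _ => mul_nonneg (hP.stateProb_nonneg _ c)
    (hP.stateLaplace_pos hs c r).le) ⟨c, Finset.mem_univ c, mul_pos hc (hP.stateLaplace_pos hs c r)⟩

theorem one_sub_markLaplace (P : DownlinkParams) (s r : ℝ) : 1 - P.markLaplace s r =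
    ∑ c : Link × Fin 4, P.linkProb c.1 (P.γ r) * P.gainProb c.2 * (1 - P.stateLaplace s c r) := by
  simp_rw [mul_sub, mul_one]
  rw [Finset.sum_sub_distrib, P.sum_stateProb]
  rfl

theorem Admissible.markLaplace_le_one (hP : P.Admissible) {s : ℝ} (hs : 0 ≤ s) (r : ℝ) :
    P.markLaplace s r ≤ 1 := by
  rw [← sub_nonneg, one_sub_markLaplace]
  exact Finset.sum_nonneg fun c _ => mul_nonneg (hP.stateProb_nonneg _ c)
    (sub_nonneg.2 (hP.stateLaplace_le_one hs c r))

end DownlinkParams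

/-! ### Averaging over the marks given the positions. -/

namespace IsDownlinkNetwork

variable {Ω : Type*} [MeasurableSpace Ω] {μ : Measure Ω}
  {P : DownlinkParams} {v : ℕ → Ω → EuclideanSpace ℝ (Fin 2)} {link : ℕ → Ω → Link}
  {pat : ℕ → Ω → Fin 4} {fad : ℕ → Ω → ℝ}

theorem measurable_seq (hnet : IsDownlinkNetwork μ P v link pat fad) :
    Measurable fun ω n => v n ω :=
  measurable_pi_lambda _ hnet.measurable_v

theorem marks_fin (hnet : IsDownlinkNetwork μ P v link pat fad) {m : ℕ}
    {B : Set (ℕ → EuclideanSpace ℝ (Fin 2))} (hB : MeasurableSet B) (q : Fin m → Link × Fin 4)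
    {T : Fin m → Set ℝ} (hT : ∀ n, MeasurableSet (T n)) :
    μ {ω | (fun n => v n ω) ∈ B ∧ ∀ n : Fin m, (link n ω, pat n ω) = q n ∧ fad n ω ∈ T n} =
      ∫⁻ ω in {ω | (fun n => v n ω) ∈ B},
        ∏ n : Fin m, ENNReal.ofReal (P.linkProb (q n).1 (P.γ ‖v (n + 1) ω‖)) *
          ENNReal.ofReal (P.gainProb (q n).2) *
          gammaMeasure (P.Nak (q n).1) (P.Nak (q n).1) (T n) ∂μ := by
  -- The values beyond `m` are arbitrary, because only indices in `range m` are tested.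
  let q' : ℕ → Link × Fin 4 := fun n => if h : n < m then q ⟨n, h⟩ else (Link.L, 0)
  let T' : ℕ → Set ℝ := fun n => if h : n < m then T ⟨n, h⟩ else ∅
  have hq' : ∀ n : Fin m, q' n = q n := fun n => by simp [q']
  have hT' : ∀ n : Fin m, T' n = T n := fun n => by simp [T']
  have hTm : ∀ n, MeasurableSet (T' n) := by
    intro n
    by_cases h : n < m
    · simpa [T', h] using hT _
    · simp [T', h]
  have key := hnet.marks B hB (Finset.range m) (fun n => (q' n).1) (fun n => (q' n).2) T' hTm
  have e1 : {ω | (fun n => v n ω) ∈ B ∧ ∀ n ∈ Finset.range m,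
      link n ω = (q' n).1 ∧ pat n ω = (q' n).2 ∧ fad n ω ∈ T' n} =
      {ω | (fun n => v n ω) ∈ B ∧ ∀ n : Fin m, (link n ω, pat n ω) = q n ∧ fad n ω ∈ T n} := by
    ext ω
    simp only [Set.mem_ofPred_eq, Finset.mem_range]
    refine and_congr_right fun _ => ⟨fun h n => ?_, fun h n hn => ?_⟩
    · have := h n n.2
      rw [hq', hT'] at this
      exact ⟨Prod.ext this.1 this.2.1, this.2.2⟩
    · have := h ⟨n, hn⟩
      rw [← hq', ← hT'] at this
      exact ⟨congrArg Prod.fst this.1, congrArg Prod.snd this.1, this.2⟩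
  rw [e1] at key
  rw [key]
  refine lintegral_congr fun ω => ?_
  rw [Finset.prod_range]
  simp only [hq', hT']

end IsDownlinkNetwork

/-- A finite measure on a product with a finite power is determined by its values on rectangles. -/
theorem eq_prod_pi_of_rectangles {α ι : Type*} [MeasurableSpace α] [Fintype ι]
    {X : ι → Type*} [∀ i, MeasurableSpace (X i)] {ρ : Measure (α × ∀ i, X i)} [IsFiniteMeasure ρ]
    {σ : Measure α} [IsFiniteMeasure σ] {Γ : ∀ i, Measure (X i)} [∀ i, IsFiniteMeasure (Γ i)]
    (h : ∀ (B : Set α) (T : ∀ i, Set (X i)), MeasurableSet B → (∀ i, MeasurableSet (T i)) →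
      ρ (B ×ˢ Set.univ.pi T) = σ B * Measure.pi Γ (Set.univ.pi T)) :
    ρ = σ.prod (Measure.pi Γ) := by
  symm
  refine Measure.prod_eq fun B T hB hT => ?_
  -- With `B` fixed, both sides are finite measures in the second coordinate, so they need only be
  -- compared on the π-system of boxes.
  obtain ⟨ν, hν'⟩ : ∃ ν : Measure (∀ i, X i), ν = (ρ.restrict (Prod.fst ⁻¹' B)).map Prod.snd :=
    ⟨_, rfl⟩
  have hν : ∀ T : Set (∀ i, X i), MeasurableSet T → ν T = ρ (B ×ˢ T) := by
    intro T hT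
    rw [hν', Measure.map_apply measurable_snd hT, Measure.restrict_apply (measurable_snd hT),
      Set.inter_comm]
    rfl
  have hfin : IsFiniteMeasure ν := by rw [hν']; infer_instance
  have hEq : ν = σ B • Measure.pi Γ := by
    refine ext_of_generate_finite _ generateFrom_pi.symm isPiSystem_pi ?_ ?_
    · rintro _ ⟨T, hT, rfl⟩
      have hT' : ∀ n, MeasurableSet (T n) := fun n => hT n (Set.mem_univ n)
      rw [hν _ (MeasurableSet.univ_pi hT'), h B T hB hT', Measure.smul_apply, smul_eq_mul]
    · have := h B (fun _ => Set.univ) hB fun _ => MeasurableSet.univ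
      rw [Set.pi_univ] at this
      rw [hν _ MeasurableSet.univ, this, Measure.smul_apply, smul_eq_mul]
  rw [← hν T hT, hEq, Measure.smul_apply, smul_eq_mul]

namespace IsDownlinkNetwork

variable {Ω : Type*} [MeasurableSpace Ω] {μ : Measure Ω} [IsProbabilityMeasure μ]
  {P : DownlinkParams} {v : ℕ → Ω → EuclideanSpace ℝ (Fin 2)} {link : ℕ → Ω → Link}
  {pat : ℕ → Ω → Fin 4} {fad : ℕ → Ω → ℝ}

omit [IsProbabilityMeasure μ] in
theorem measurableSet_state (hnet : IsDownlinkNetwork μ P v link pat fad) {m : ℕ}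
    (q : Fin m → Link × Fin 4) :
    MeasurableSet {ω | ∀ n : Fin m, (link n ω, pat n ω) = q n} := by
  simp only [Set.ofPred_forall]
  exact MeasurableSet.iInter fun n =>
    ((hnet.measurable_link n).prodMk (hnet.measurable_pat n)) (measurableSet_singleton (q n))

/-- On the event that the first `m` interferers have the states `q`, the positions and the fading
amplitudes of these interferers have a product law. -/
theorem map_restrict_state (hP : P.Admissible) (hnet : IsDownlinkNetwork μ P v link pat fad)
    {m : ℕ} (q : Fin m → Link × Fin 4) :
    (μ.restrict {ω | ∀ n : Fin m, (link n ω, pat n ω) = q n}).map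
        (fun ω => (fun n => v n ω, fun n : Fin m => fad n ω)) =
      ((μ.map fun ω n => v n ω).withDensity fun x => ∏ n : Fin m,
        ENNReal.ofReal (P.linkProb (q n).1 (P.γ ‖x (n + 1)‖)) *
          ENNReal.ofReal (P.gainProb (q n).2)).prod
        (Measure.pi fun n : Fin m => gammaMeasure (P.Nak (q n).1) (P.Nak (q n).1)) := by
  have hprob : ∀ n : Fin m, IsProbabilityMeasure
      (gammaMeasure (P.Nak (q n).1) (P.Nak (q n).1)) := fun n => by
    have : (0 : ℝ) < P.Nak (q n).1 := by exact_mod_cast hP.Nak_pos _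
    exact isProbabilityMeasure_gammaMeasure this this
  have hV := hnet.measurable_seq
  have hF : Measurable fun ω (n : Fin m) => fad n ω :=
    measurable_pi_lambda _ fun n => hnet.measurable_fad n
  have hw : Measurable fun x : ℕ → EuclideanSpace ℝ (Fin 2) => ∏ n : Fin m,
      ENNReal.ofReal (P.linkProb (q n).1 (P.γ ‖x (n + 1)‖)) *
        ENNReal.ofReal (P.gainProb (q n).2) := by
    refine Finset.measurable_prod _ fun n _ => ?_
    refine Measurable.mul_const (ENNReal.measurable_ofReal.comp ?_) _
    exact (P.measurable_linkProb (q n).1).comp (measurable_pi_apply _).norm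
  have hVprob : IsProbabilityMeasure (μ.map fun ω n => v n ω) :=
    Measure.isProbabilityMeasure_map hV.aemeasurable
  -- The weight is at most the constant product of the gain probabilities, which gives the
  -- finiteness required by `eq_prod_pi_of_rectangles`.
  have hwfin : IsFiniteMeasure ((μ.map fun ω n => v n ω).withDensity fun x => ∏ n : Fin m,
      ENNReal.ofReal (P.linkProb (q n).1 (P.γ ‖x (n + 1)‖)) *
        ENNReal.ofReal (P.gainProb (q n).2)) := by
    have hle : ∀ x : ℕ → EuclideanSpace ℝ (Fin 2), ∏ n : Fin m,
        ENNReal.ofReal (P.linkProb (q n).1 (P.γ ‖x (n + 1)‖)) *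
          ENNReal.ofReal (P.gainProb (q n).2) ≤
        ∏ n : Fin m, ENNReal.ofReal (P.gainProb (q n).2) := by
      intro x
      refine Finset.prod_le_prod' fun n _ => mul_le_of_le_one_left' ?_
      rw [ENNReal.ofReal_le_one]
      exact P.linkProb_le_one _ _
    have hc : ∏ n : Fin m, ENNReal.ofReal (P.gainProb (q n).2) ≠ ∞ :=
      ENNReal.prod_ne_top fun n _ => ENNReal.ofReal_ne_top
    refine isFiniteMeasure_withDensity (ne_top_of_le_ne_top hc ?_)
    refine (lintegral_mono hle).trans ?_
    rw [lintegral_const, measure_univ, mul_one]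
  have hwV : Measurable fun ω => ∏ n : Fin m,
      ENNReal.ofReal (P.linkProb (q n).1 (P.γ ‖v (n + 1) ω‖)) *
        ENNReal.ofReal (P.gainProb (q n).2) := by
    refine Finset.measurable_prod _ fun n _ => ?_
    refine Measurable.mul_const (ENNReal.measurable_ofReal.comp ?_) _
    exact (P.measurable_linkProb (q n).1).comp (hnet.measurable_v (n + 1)).norm
  refine eq_prod_pi_of_rectangles fun B T hB hT => ?_
  have hBT : MeasurableSet (B ×ˢ Set.univ.pi T) := hB.prod (MeasurableSet.univ_pi hT)
  rw [withDensity_apply _ hB, Measure.restrict_map hV hB, lintegral_map hw hV,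
    Measure.map_apply (hV.prodMk hF) hBT, Measure.restrict_apply ((hV.prodMk hF) hBT),
    Measure.pi_pi, ← lintegral_mul_const _ hwV]
  have key := hnet.marks_fin hB q hT
  simp only [Finset.prod_mul_distrib] at key ⊢
  refine Eq.trans (congrArg μ ?_) key
  ext ω
  simp only [Set.mem_inter_iff, Set.mem_preimage, Set.mem_prod, Set.mem_pi, Set.mem_univ,
    true_imp_iff, Set.mem_ofPred_eq, and_assoc]
  exact and_congr_right fun _ => ⟨fun h n => ⟨h.2 n, h.1 n⟩,
    fun h => ⟨fun n => (h n).2, fun n => (h n).1⟩⟩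

/-- The event is split according to the finitely many state lists `q` of the first `m` interferers.
On each piece the fading is independent of the positions, so Fubini and the Gamma transform give a
product. Summing over `q` turns the sum of products into the product of the mixtures `markLaplace`.
-/
theorem setLIntegral_expNeg_sum (hP : P.Admissible)
    (hnet : IsDownlinkNetwork μ P v link pat fad) {s : ℝ} (hs : 0 ≤ s) (m : ℕ)
    {B : Set (ℕ → EuclideanSpace ℝ (Fin 2))} (hB : MeasurableSet B) :
    ∫⁻ ω in {ω | (fun n => v n ω) ∈ B}, ENNReal.ofReal (expNeg (∑ n : Fin m,
        ENNReal.ofReal s * ENNReal.ofReal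
          (P.pathLoss (link n ω) ‖v (n + 1) ω‖ * P.gain (pat n ω) * fad n ω))) ∂μ =
      ∫⁻ ω in {ω | (fun n => v n ω) ∈ B},
        ∏ n : Fin m, ENNReal.ofReal (P.markLaplace s ‖v (n + 1) ω‖) ∂μ := by
  have hV := hnet.measurable_seq
  have hF : Measurable fun ω (n : Fin m) => fad n ω :=
    measurable_pi_lambda _ fun n => hnet.measurable_fad n
  have hBm : MeasurableSet {ω | (fun n => v n ω) ∈ B} := hV hB
  obtain ⟨D, hD⟩ : ∃ D : (Fin m → Link × Fin 4) → Set Ω,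
      D = fun q => {ω | ∀ n : Fin m, (link n ω, pat n ω) = q n} := ⟨_, rfl⟩
  have hDm : ∀ q, MeasurableSet (D q) := fun q => by
    rw [hD]; exact hnet.measurableSet_state q
  have hDd : Pairwise (Function.onFun Disjoint fun q => {ω | (fun n => v n ω) ∈ B} ∩ D q) := by
    intro q q' hqq'
    refine Set.disjoint_left.2 fun ω h1 h2 => hqq' (funext fun n => ?_)
    rw [hD] at h1 h2
    exact (h1.2 n).symm.trans (h2.2 n)
  have hDu : {ω | (fun n => v n ω) ∈ B} = ⋃ q, {ω | (fun n => v n ω) ∈ B} ∩ D q := by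
    rw [← Set.inter_iUnion]
    symm
    refine Set.inter_eq_left.2 fun ω _ => Set.mem_iUnion.2 ⟨fun n => (link n ω, pat n ω), ?_⟩
    rw [hD]
    exact fun n => rfl
  conv_lhs => rw [hDu]
  rw [lintegral_iUnion (fun q => hBm.inter (hDm q)) hDd, tsum_fintype]
  let h : Link × Fin 4 → ℝ → ℝ → ℝ≥0∞ := fun c r y => ENNReal.ofReal (expNeg
    (ENNReal.ofReal s * ENNReal.ofReal (P.pathLoss c.1 r * P.gain c.2 * y)))
  have hterm : ∀ q : Fin m → Link × Fin 4,
      ∫⁻ ω in {ω | (fun n => v n ω) ∈ B} ∩ D q, ENNReal.ofReal (expNeg (∑ n : Fin m,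
        ENNReal.ofReal s * ENNReal.ofReal
          (P.pathLoss (link n ω) ‖v (n + 1) ω‖ * P.gain (pat n ω) * fad n ω))) ∂μ =
      ∫⁻ ω in {ω | (fun n => v n ω) ∈ B}, ∏ n : Fin m, ENNReal.ofReal
        (P.linkProb (q n).1 (P.γ ‖v (n + 1) ω‖) * P.gainProb (q n).2 *
          P.stateLaplace s (q n) ‖v (n + 1) ω‖) ∂μ := by
    intro q
    have hprob : ∀ n : Fin m, IsProbabilityMeasure
        (gammaMeasure (P.Nak (q n).1) (P.Nak (q n).1)) := fun n => by
      have : (0 : ℝ) < P.Nak (q n).1 := by exact_mod_cast hP.Nak_pos _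
      exact isProbabilityMeasure_gammaMeasure this this
    have hG : Measurable fun z : (ℕ → EuclideanSpace ℝ (Fin 2)) × (Fin m → ℝ) =>
        B.indicator (fun _ => (1 : ℝ≥0∞)) z.1 *
          ∏ n : Fin m, h (q n) ‖z.1 (n + 1)‖ (z.2 n) := by
      refine ((measurable_const.indicator hB).comp measurable_fst).mul
        (Finset.measurable_prod _ fun n _ => ?_)
      fun_prop
    have hw : Measurable fun x : ℕ → EuclideanSpace ℝ (Fin 2) => ∏ n : Fin m,
        ENNReal.ofReal (P.linkProb (q n).1 (P.γ ‖x (n + 1)‖)) *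
          ENNReal.ofReal (P.gainProb (q n).2) := by
      refine Finset.measurable_prod _ fun n _ => ?_
      refine Measurable.mul_const (ENNReal.measurable_ofReal.comp ?_) _
      exact (P.measurable_linkProb (q n).1).comp (measurable_pi_apply _).norm
    have e1 : ∫⁻ ω in {ω | (fun n => v n ω) ∈ B} ∩ D q, ENNReal.ofReal (expNeg (∑ n : Fin m,
        ENNReal.ofReal s * ENNReal.ofReal
          (P.pathLoss (link n ω) ‖v (n + 1) ω‖ * P.gain (pat n ω) * fad n ω))) ∂μ =
        ∫⁻ z, B.indicator (fun _ => (1 : ℝ≥0∞)) z.1 *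
          ∏ n : Fin m, h (q n) ‖z.1 (n + 1)‖ (z.2 n)
          ∂((μ.restrict (D q)).map (fun ω => (fun n => v n ω, fun n : Fin m => fad n ω))) := by
      rw [lintegral_map hG (hV.prodMk hF), ← Measure.restrict_restrict hBm,
        ← lintegral_indicator hBm]
      refine lintegral_congr_ae ?_
      filter_upwards [ae_restrict_mem (hDm q)] with ω hω
      by_cases hωB : (fun n => v n ω) ∈ B
      · rw [Set.indicator_of_mem (by exact hωB), Set.indicator_of_mem hωB, one_mul, expNeg_sum,
          ENNReal.ofReal_prod_of_nonneg fun _ _ => expNeg_nonneg _]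
        refine Finset.prod_congr rfl fun n _ => ?_
        rw [hD] at hω
        have := hω n
        simp only [h, ← this]
      · rw [Set.indicator_of_notMem (by exact hωB), Set.indicator_of_notMem hωB, zero_mul]
    rw [e1]
    simp only [hD]
    rw [map_restrict_state hP hnet q, lintegral_prod _ hG.aemeasurable]
    have e2 : ∀ x : ℕ → EuclideanSpace ℝ (Fin 2),
        ∫⁻ y, B.indicator (fun _ => (1 : ℝ≥0∞)) x * ∏ n : Fin m, h (q n) ‖x (n + 1)‖ (y n)
          ∂(Measure.pi fun n : Fin m => gammaMeasure (P.Nak (q n).1) (P.Nak (q n).1)) =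
        B.indicator (fun _ => (1 : ℝ≥0∞)) x *
          ∏ n : Fin m, ENNReal.ofReal (P.stateLaplace s (q n) ‖x (n + 1)‖) := by
      intro x
      rw [lintegral_const_mul _ (by fun_prop), lintegral_pi_prod _
        (f := fun n y => h (q n) ‖x (n + 1)‖ y) (fun n => by fun_prop)]
      congr 1
      refine Finset.prod_congr rfl fun n _ => ?_
      exact lintegral_gammaMeasure_expNeg (hP.Nak_pos _) hs
        (mul_nonneg (hP.pathLoss_nonneg _ _) (hP.gain_nonneg _))
    simp only [e2]
    have hL : Measurable fun x : ℕ → EuclideanSpace ℝ (Fin 2) =>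
        B.indicator (fun _ => (1 : ℝ≥0∞)) x *
          ∏ n : Fin m, ENNReal.ofReal (P.stateLaplace s (q n) ‖x (n + 1)‖) := by
      refine (measurable_const.indicator hB).mul (Finset.measurable_prod _ fun n _ => ?_)
      exact ENNReal.measurable_ofReal.comp
        ((P.measurable_stateLaplace s (q n)).comp (measurable_pi_apply _).norm)
    rw [lintegral_withDensity_eq_lintegral_mul _ hw hL, lintegral_map (hw.mul hL) hV,
      ← lintegral_indicator hBm]
    refine lintegral_congr fun ω => ?_
    by_cases hωB : (fun n => v n ω) ∈ B
    · simp only [Pi.mul_apply]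
      rw [Set.indicator_of_mem hωB, Set.indicator_of_mem (by exact hωB), one_mul,
        ← Finset.prod_mul_distrib]
      refine Finset.prod_congr rfl fun n _ => ?_
      rw [ENNReal.ofReal_mul (hP.stateProb_nonneg _ _), ENNReal.ofReal_mul (P.linkProb_nonneg _ _)]
    · simp only [Pi.mul_apply]
      rw [Set.indicator_of_notMem hωB, Set.indicator_of_notMem (by exact hωB), zero_mul, mul_zero]
  simp only [hterm]
  rw [← lintegral_finsetSum]
  · refine lintegral_congr fun ω => ?_
    unfold DownlinkParams.markLaplace
    simp_rw [ENNReal.ofReal_sum_of_nonneg fun (c : Link × Fin 4) _ =>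
      mul_nonneg (hP.stateProb_nonneg _ c) (hP.stateLaplace_pos hs c _).le]
    rw [Finset.prod_univ_sum, Fintype.piFinset_univ]
  · intro q _
    refine Finset.measurable_prod _ fun n _ => ENNReal.measurable_ofReal.comp ?_
    have := (hnet.measurable_v (n + 1)).norm
    exact (((P.measurable_linkProb _).comp this).mul_const _).mul
      ((P.measurable_stateLaplace s (q n)).comp this)

/-- The interference, averaged over the marks given the positions. -/
theorem setIntegral_expNeg_interference (hP : P.Admissible)
    (hnet : IsDownlinkNetwork μ P v link pat fad) {s : ℝ} (hs : 0 ≤ s)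
    {B : Set (ℕ → EuclideanSpace ℝ (Fin 2))} (hB : MeasurableSet B) :
    ∫ ω in {ω | (fun n => v n ω) ∈ B},
        expNeg (ENNReal.ofReal s * interference P v link pat fad ω) ∂μ =
      ∫ ω in {ω | (fun n => v n ω) ∈ B},
        expNeg (∑' n, ENNReal.ofReal (-Real.log (P.markLaplace s ‖v (n + 1) ω‖))) ∂μ := by
  have hterm : ∀ n, Measurable fun ω => ENNReal.ofReal s * ENNReal.ofReal
      (P.pathLoss (link n ω) ‖v (n + 1) ω‖ * P.gain (pat n ω) * fad n ω) := by
    intro n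
    have h1 : Measurable fun ω => P.pathLoss (link n ω) ‖v (n + 1) ω‖ := by
      have : Measurable fun z : ℝ × Link => P.pathLoss z.2 z.1 :=
        measurable_from_prod_countable_left fun κ => P.measurable_pathLoss κ
      exact this.comp ((hnet.measurable_v (n + 1)).norm.prodMk (hnet.measurable_link n))
    have h2 : Measurable fun ω => P.gain (pat n ω) :=
      (measurable_of_finite P.gain).comp (hnet.measurable_pat n)
    have h3 := hnet.measurable_fad n
    fun_prop
  have hlog : ∀ n, Measurable fun ω =>
      ENNReal.ofReal (-Real.log (P.markLaplace s ‖v (n + 1) ω‖)) := by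
    intro n
    exact ENNReal.measurable_ofReal.comp (Real.measurable_log.comp
      ((P.measurable_markLaplace s).comp (hnet.measurable_v (n + 1)).norm)).neg
  have hfin : ∀ m, ∫ ω in {ω | (fun n => v n ω) ∈ B}, expNeg (∑ n ∈ Finset.range m,
        ENNReal.ofReal s * ENNReal.ofReal
          (P.pathLoss (link n ω) ‖v (n + 1) ω‖ * P.gain (pat n ω) * fad n ω)) ∂μ =
      ∫ ω in {ω | (fun n => v n ω) ∈ B}, expNeg (∑ n ∈ Finset.range m,
        ENNReal.ofReal (-Real.log (P.markLaplace s ‖v (n + 1) ω‖))) ∂μ := by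
    intro m
    have key := setLIntegral_expNeg_sum hP hnet hs m hB
    rw [integral_eq_lintegral_of_nonneg_ae (ae_of_all _ fun _ => expNeg_nonneg _)
        (measurable_expNeg.comp
          (Finset.measurable_sum _ fun n _ => hterm n)).aestronglyMeasurable,
      integral_eq_lintegral_of_nonneg_ae (ae_of_all _ fun _ => expNeg_nonneg _)
        (measurable_expNeg.comp
          (Finset.measurable_sum _ fun n _ => hlog n)).aestronglyMeasurable]
    congr 1
    simp only [Finset.sum_range]
    rw [key]
    refine lintegral_congr fun ω => ?_
    rw [expNeg_sum, ENNReal.ofReal_prod_of_nonneg fun _ _ => expNeg_nonneg _]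
    refine Finset.prod_congr rfl fun n _ => ?_
    rw [expNeg_ofReal (neg_nonneg.2 (Real.log_nonpos (hP.markLaplace_pos hs _).le
      (hP.markLaplace_le_one hs _))), neg_neg, Real.exp_log (hP.markLaplace_pos hs _)]
  -- Both sides are known for the first `m` interferers; letting `m` tend to infinity gives the full
  -- sums, even where they are infinite.
  have hL := tendsto_integral_expNeg (μ := μ.restrict {ω | (fun n => v n ω) ∈ B})
    (f := fun m ω => ∑ n ∈ Finset.range m, ENNReal.ofReal s * ENNReal.ofReal
      (P.pathLoss (link n ω) ‖v (n + 1) ω‖ * P.gain (pat n ω) * fad n ω))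
    (fun m => (Finset.measurable_sum _ fun n _ => hterm n).aemeasurable)
    (ae_of_all _ fun ω => ENNReal.summable.hasSum.tendsto_sum_nat)
  have hR := tendsto_integral_expNeg (μ := μ.restrict {ω | (fun n => v n ω) ∈ B})
    (f := fun m ω => ∑ n ∈ Finset.range m,
      ENNReal.ofReal (-Real.log (P.markLaplace s ‖v (n + 1) ω‖)))
    (fun m => (Finset.measurable_sum _ fun n _ => hlog n).aemeasurable)
    (ae_of_all _ fun ω => ENNReal.summable.hasSum.tendsto_sum_nat)
  simp only [ENNReal.tsum_mul_left] at hL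
  simp_rw [hfin] at hL
  exact tendsto_nhds_unique hL hR

end IsDownlinkNetwork

/-! ### The Gauss hypergeometric function `₂F₁(-δ, N; 1 - δ; z)` -/

noncomputable section

/-- The sum `((1 - u)⁻ᴺ - 1) / u`. -/
def geomKernel (N : ℕ) (u : ℂ) : ℂ := ∑ i ∈ Finset.range N, ((1 - u) ^ (i + 1))⁻¹

/-- The derivative of `geomKernel N`. -/
def geomKernelDeriv (N : ℕ) (u : ℂ) : ℂ :=
  ∑ i ∈ Finset.range N, ((i + 1 : ℕ) : ℂ) * ((1 - u) ^ (i + 2))⁻¹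

/-- An integral representation of `₂F₁(-δ, N; 1 - δ; z)` on the cut plane. -/
def hypergeometricIntegral (δ : ℝ) (N : ℕ) (z : ℂ) : ℂ :=
  1 - δ * (z * ∫ t in Set.Ioc (0 : ℝ) 1, ((t ^ (-δ) : ℝ) : ℂ) * geomKernel N (t * z))

end

/-- The plane cut along `[1, ∞)`. -/
def cutPlane : Set ℂ := {z | 1 - z ∈ Complex.slitPlane}

theorem isOpen_cutPlane : IsOpen cutPlane :=
  Complex.isOpen_slitPlane.preimage (continuous_const.sub continuous_id)

/-- The cut plane is star-shaped about `0`. This keeps the segment of integration `t z` inside it,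
and also makes it connected for the identity theorem. -/
theorem mul_mem_cutPlane {z : ℂ} (hz : z ∈ cutPlane) {t : ℝ} (ht : t ∈ Set.Icc (0 : ℝ) 1) :
    (t : ℂ) * z ∈ cutPlane := by
  have h : (1 - z : ℂ) ∈ Complex.slitPlane := hz
  have := StarConvex.add_smul_mem Complex.starConvex_one_slitPlane (y := -z)
    (by simpa [sub_eq_add_neg] using h) ht.1 ht.2
  show 1 - (t : ℂ) * z ∈ Complex.slitPlane
  convert this using 1
  simp [sub_eq_add_neg]

theorem zero_mem_cutPlane : (0 : ℂ) ∈ cutPlane := by simp [cutPlane]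

theorem isPreconnected_cutPlane : IsPreconnected cutPlane := by
  have h : StarConvex ℝ (0 : ℂ) cutPlane := by
    rw [starConvex_zero_iff]
    intro z hz a ha0 ha1
    rw [Complex.real_smul]
    exact mul_mem_cutPlane hz ⟨ha0, ha1⟩
  exact (h.isPathConnected zero_mem_cutPlane).isConnected.isPreconnected

theorem one_sub_ne_zero_of_mem_cutPlane {z : ℂ} (hz : z ∈ cutPlane) : 1 - z ≠ 0 :=
  Complex.slitPlane_ne_zero hz

theorem ball_subset_cutPlane : Metric.ball (0 : ℂ) 1 ⊆ cutPlane := by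
  intro z hz
  have h := Complex.mem_slitPlane_of_norm_lt_one (z := -z) (by simpa using hz)
  simpa [cutPlane, sub_eq_add_neg] using h

theorem neg_ofReal_mem_cutPlane {x : ℝ} (hx : 0 ≤ x) : ((-x : ℝ) : ℂ) ∈ cutPlane := by
  refine Complex.mem_slitPlane_iff.2 (Or.inl ?_)
  simp only [Complex.sub_re, Complex.one_re, Complex.ofReal_re]
  linarith

theorem hasDerivAt_geomKernel (N : ℕ) {u : ℂ} (hu : u ∈ cutPlane) :
    HasDerivAt (geomKernel N) (geomKernelDeriv N u) u := by
  have h0 := one_sub_ne_zero_of_mem_cutPlane hu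
  unfold geomKernel geomKernelDeriv
  refine HasDerivAt.fun_sum fun i _ => ?_
  have h1 : HasDerivAt (fun u : ℂ => 1 - u) (-1) u := by
    simpa using (hasDerivAt_id u).const_sub 1
  have h2 := (h1.pow (i + 1)).inv (pow_ne_zero _ h0)
  convert! h2 using 1
  rw [Nat.add_sub_cancel, Pi.pow_apply]
  field_simp
  ring

theorem continuousOn_geomKernelDeriv (N : ℕ) : ContinuousOn (geomKernelDeriv N) cutPlane := by
  unfold geomKernelDeriv
  refine continuousOn_finsetSum _ fun i _ => continuousOn_const.mul (ContinuousOn.inv₀ ?_ ?_)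
  · fun_prop
  · exact fun u hu => pow_ne_zero _ (one_sub_ne_zero_of_mem_cutPlane hu)

theorem continuousOn_geomKernel (N : ℕ) : ContinuousOn (geomKernel N) cutPlane :=
  fun _ hu => (hasDerivAt_geomKernel N hu).continuousAt.continuousWithinAt

/-- Dividing out the zero at `u = 0` turns the singular Euler integrand `t^(-δ-1) ((1 - t z)⁻ᴺ - 1)`
into `z t^(-δ)` times a continuous function, integrable at `0` for `δ < 1`. -/
theorem mul_geomKernel (N : ℕ) {u : ℂ} (hu : 1 - u ≠ 0) :
    u * geomKernel N u = ((1 - u) ^ N)⁻¹ - 1 := by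
  unfold geomKernel
  induction N with
  | zero => simp
  | succ n ih =>
    rw [Finset.sum_range_succ, mul_add, ih]
    field_simp
    ring

theorem integrableOn_rpow_neg {δ : ℝ} (hδ : δ < 1) :
    IntegrableOn (fun t : ℝ => t ^ (-δ)) (Set.Ioc 0 1) := by
  rw [← intervalIntegrable_iff_integrableOn_Ioc_of_le zero_le_one]
  exact intervalIntegral.intervalIntegrable_rpow' (by linarith)

theorem continuousOn_comp_ofReal_mul {f : ℂ → ℂ} (hf : ContinuousOn f cutPlane) {z : ℂ}
    (hz : z ∈ cutPlane) : ContinuousOn (fun t : ℝ => f (t * z)) (Set.Icc 0 1) :=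
  hf.comp (by fun_prop) fun _ ht => mul_mem_cutPlane hz ht

theorem integrableOn_rpow_mul {δ : ℝ} (hδ : δ < 1) {g : ℝ → ℂ}
    (hg : ContinuousOn g (Set.Icc 0 1)) :
    IntegrableOn (fun t : ℝ => ((t ^ (-δ) : ℝ) : ℂ) * g t) (Set.Ioc 0 1) := by
  obtain ⟨C, hC⟩ := isCompact_Icc.exists_bound_of_continuousOn hg
  refine Integrable.mul_bdd (c := C) (integrableOn_rpow_neg hδ).ofReal ?_ ?_
  · exact (hg.mono Set.Ioc_subset_Icc_self).aestronglyMeasurable measurableSet_Ioc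
  · filter_upwards [ae_restrict_mem measurableSet_Ioc] with t ht
    exact hC t (Set.Ioc_subset_Icc_self ht)

/-- Differentiation under the integral: for `z` in a small closed ball and `t ∈ [0, 1]` the kernel
derivative is bounded by compactness, so a multiple of `t^(-δ)` dominates. -/
theorem differentiableOn_hypergeometricIntegral {δ : ℝ} (hδ : δ < 1) (N : ℕ) :
    DifferentiableOn ℂ (hypergeometricIntegral δ N) cutPlane := by
  intro z₀ hz₀
  obtain ⟨ε, hε, hball⟩ := Metric.nhds_basis_closedBall.mem_iff.1 (isOpen_cutPlane.mem_nhds hz₀)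
  have hcomp : IsCompact (Set.Icc (0 : ℝ) 1 ×ˢ Metric.closedBall z₀ ε) :=
    isCompact_Icc.prod (isCompact_closedBall z₀ ε)
  have hcont : ContinuousOn (fun p : ℝ × ℂ => geomKernelDeriv N (p.1 * p.2))
      (Set.Icc (0 : ℝ) 1 ×ˢ Metric.closedBall z₀ ε) :=
    (continuousOn_geomKernelDeriv N).comp (by fun_prop)
      fun p hp => mul_mem_cutPlane (hball hp.2) hp.1
  obtain ⟨C, hC⟩ := hcomp.exists_bound_of_continuousOn hcont
  have hder := hasDerivAt_integral_of_dominated_loc_of_deriv_le (𝕜 := ℂ)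
    (μ := volume.restrict (Set.Ioc (0 : ℝ) 1))
    (F := fun z t => ((t ^ (-δ) : ℝ) : ℂ) * geomKernel N (t * z))
    (F' := fun z t => ((t ^ (-δ) : ℝ) : ℂ) * (geomKernelDeriv N (t * z) * t))
    (x₀ := z₀) (s := Metric.ball z₀ ε) (bound := fun t => t ^ (-δ) * C)
    (Metric.ball_mem_nhds z₀ hε) ?_ ?_ ?_ ?_ ?_ ?_
  · have h := ((hasDerivAt_id z₀).mul hder.2).const_mul (δ : ℂ)
    exact (h.const_sub 1).differentiableAt.differentiableWithinAt
  · filter_upwards [isOpen_cutPlane.mem_nhds hz₀] with z hz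
    exact (integrableOn_rpow_mul hδ
      (continuousOn_comp_ofReal_mul (continuousOn_geomKernel N) hz)).aestronglyMeasurable
  · exact integrableOn_rpow_mul hδ
      (continuousOn_comp_ofReal_mul (continuousOn_geomKernel N) hz₀)
  · refine (integrableOn_rpow_mul hδ ?_).aestronglyMeasurable
    exact (continuousOn_comp_ofReal_mul (continuousOn_geomKernelDeriv N) hz₀).mul (by fun_prop)
  · filter_upwards [ae_restrict_mem measurableSet_Ioc] with t ht z hz
    have h1 := hC (t, z) ⟨Set.Ioc_subset_Icc_self ht, Metric.ball_subset_closedBall hz⟩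
    have h2 : 0 ≤ t ^ (-δ) := Real.rpow_nonneg ht.1.le _
    rw [norm_mul, norm_mul, Complex.norm_real, Complex.norm_real, Real.norm_of_nonneg h2,
      Real.norm_of_nonneg ht.1.le]
    refine mul_le_mul_of_nonneg_left ?_ h2
    exact (mul_le_of_le_one_right (norm_nonneg _) ht.2).trans h1
  · exact (integrableOn_rpow_neg hδ).mul_const C
  · filter_upwards [ae_restrict_mem measurableSet_Ioc] with t ht z hz
    have h1 : HasDerivAt (fun z : ℂ => (t : ℂ) * z) (t : ℂ) z := by
      simpa using (hasDerivAt_id z).const_mul (t : ℂ)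
    have h2 := hasDerivAt_geomKernel N (mul_mem_cutPlane
      (hball (Metric.ball_subset_closedBall hz)) (Set.Ioc_subset_Icc_self ht))
    exact (h2.comp z h1).const_mul _

/-- Both sides are the product `(-δ)(1-δ)⋯(n-δ)`. The quotient of Pochhammer symbols in the
hypergeometric coefficient thus collapses to `-δ / (n - δ)`. -/
theorem ascPochhammer_neg_mul (δ : ℂ) (n : ℕ) :
    (ascPochhammer ℂ n).eval (-δ) * (n - δ) = -δ * (ascPochhammer ℂ n).eval (1 - δ) := by
  induction n with
  | zero => simp
  | succ n ih =>
    rw [ascPochhammer_succ_eval, ascPochhammer_succ_eval]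
    have : (-δ + n : ℂ) = n - δ := by ring
    rw [this, ih]
    push_cast
    ring

theorem hypergeometric_coefficient {δ : ℝ} (h0 : 0 < δ) (h1 : δ < 1) (M n : ℕ) :
    ((n.factorial : ℂ)⁻¹ * (ascPochhammer ℂ n).eval (-(δ : ℂ)) *
      (ascPochhammer ℂ n).eval ((M + 1 : ℕ) : ℂ) * ((ascPochhammer ℂ n).eval (1 - (δ : ℂ)))⁻¹) =
      -δ * ((n + M).choose M / (n - δ)) := by
  have hn : ((n : ℂ) - δ) ≠ 0 := by
    intro h
    have h2 : ((n : ℝ) - δ) = 0 := by exact_mod_cast h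
    rcases Nat.eq_zero_or_pos n with rfl | hpos
    · simp at h2; linarith
    · have : (1 : ℝ) ≤ n := by exact_mod_cast hpos
      linarith
  have hp : (ascPochhammer ℂ n).eval (1 - (δ : ℂ)) ≠ 0 := by
    rw [Ne, ascPochhammer_eval_eq_zero_iff]
    rintro ⟨k, -, hk⟩
    have h2 : (k : ℝ) = -(1 - δ) := by exact_mod_cast hk
    have : (0 : ℝ) ≤ k := k.cast_nonneg
    linarith
  have hc : (ascPochhammer ℂ n).eval ((M + 1 : ℕ) : ℂ) =
      (n.factorial : ℂ) * ((n + M).choose M : ℂ) := by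
    rw [ascPochhammer_nat_eq_natCast_ascFactorial, Nat.ascFactorial_eq_factorial_mul_choose,
      add_comm M n, Nat.choose_symm_add]
    push_cast; rfl
  have hf : (n.factorial : ℂ) ≠ 0 := by exact_mod_cast n.factorial_ne_zero
  have key := ascPochhammer_neg_mul (δ : ℂ) n
  rw [hc]
  field_simp
  linear_combination ((n + M).choose M : ℂ) * key

theorem integral_rpow_sub {δ : ℝ} (h1 : δ < 1) (n : ℕ) :
    ∫ t in Set.Ioc (0 : ℝ) 1, t ^ (-δ) * t ^ n = 1 / ((n + 1 : ℕ) - δ) := by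
  have : ∀ t ∈ Set.Ioc (0 : ℝ) 1, t ^ (-δ) * t ^ n = t ^ (n - δ) := by
    intro t ht
    rw [← Real.rpow_natCast, ← Real.rpow_add ht.1]; ring_nf
  have hn : (0 : ℝ) ≤ n := n.cast_nonneg
  rw [setIntegral_congr_fun measurableSet_Ioc this, ← intervalIntegral.integral_of_le zero_le_one,
    integral_rpow (Or.inl (by linarith))]
  rw [Real.one_rpow, Real.zero_rpow (by linarith)]
  push_cast
  ring_nf

/-- This is the binomial series of `(1 - u)^(-(M+1))` with its constant term removed, divided by
`u`; the point `u = 0` is treated apart. -/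
theorem hasSum_geomKernel (M : ℕ) {u : ℂ} (hu : ‖u‖ < 1) :
    HasSum (fun n : ℕ => ((n + 1 + M).choose M : ℂ) * u ^ n) (geomKernel (M + 1) u) := by
  have hs := hasSum_choose_mul_geometric_of_norm_lt_one M hu
  have hu1 : 1 - u ≠ 0 := one_sub_ne_zero_of_mem_cutPlane (ball_subset_cutPlane (by simpa using hu))
  by_cases h0 : u = 0
  · subst h0
    have h2 : geomKernel (M + 1) 0 = ((0 + 1 + M).choose M : ℂ) * 0 ^ 0 := by
      have : (0 + 1 + M).choose M = M + 1 := by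
        rw [show 0 + 1 + M = M + 1 by ring, Nat.choose_succ_self_right]
      simp [geomKernel, this]
    rw [h2]
    exact hasSum_single 0 fun n hn => by simp [hn]
  · have h2 := (hasSum_nat_add_iff' 1).2 hs
    have h3 := h2.mul_left u⁻¹
    convert! h3 using 1
    · ext n
      field_simp
      ring
    · have := mul_geomKernel (M + 1) hu1
      simp only [Finset.range_one, Finset.sum_singleton, zero_add, pow_zero, mul_one,
        Nat.choose_self, Nat.cast_one, one_div]
      rw [← this]
      field_simp

/-- The binomial series is integrated term by term against `t^(-δ)`. Since `n + 1 - δ ≥ 1 - δ`, the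
sum of the integrated norms is controlled by the binomial series at `‖z‖`. -/
theorem hypergeometricIntegral_eq_hypergeometric {δ : ℝ} (h0 : 0 < δ) (h1 : δ < 1) (M : ℕ) {z : ℂ}
    (hz : ‖z‖ < 1) : hypergeometricIntegral δ (M + 1) z =
      ordinaryHypergeometric (-(δ : ℂ)) ((M + 1 : ℕ) : ℂ) (1 - (δ : ℂ)) z := by
  have hint := hasSum_integral_of_summable_integral_norm
    (μ := volume.restrict (Set.Ioc (0 : ℝ) 1))
    (F := fun (n : ℕ) (t : ℝ) => ((t ^ (-δ) * t ^ n : ℝ) : ℂ) *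
      (((n + 1 + M).choose M : ℂ) * z ^ n)) ?_ ?_
  · have h2 : ∀ t ∈ Set.Ioc (0 : ℝ) 1, ∑' n : ℕ, ((t ^ (-δ) * t ^ n : ℝ) : ℂ) *
        (((n + 1 + M).choose M : ℂ) * z ^ n) =
        ((t ^ (-δ) : ℝ) : ℂ) * geomKernel (M + 1) (t * z) := by
      intro t ht
      have htz : ‖(t : ℂ) * z‖ < 1 := by
        rw [norm_mul, Complex.norm_real, Real.norm_of_nonneg ht.1.le]
        exact lt_of_le_of_lt (mul_le_of_le_one_left (norm_nonneg _) ht.2) hz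
      have := (hasSum_geomKernel M htz).mul_left ((t ^ (-δ) : ℝ) : ℂ)
      rw [← this.tsum_eq]
      refine tsum_congr fun n => ?_
      push_cast
      ring
    rw [setIntegral_congr_fun measurableSet_Ioc h2] at hint
    have hterm : ∀ n : ℕ, ∫ t in Set.Ioc (0 : ℝ) 1, ((t ^ (-δ) * t ^ n : ℝ) : ℂ) *
        (((n + 1 + M).choose M : ℂ) * z ^ n) =
        ((n + 1 + M).choose M : ℂ) / (((n + 1 : ℕ) : ℂ) - δ) * z ^ n := by
      intro n
      rw [integral_mul_const, integral_complex_ofReal, integral_rpow_sub h1]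
      push_cast
      ring
    simp_rw [hterm] at hint
    have hshift : HasSum (fun n : ℕ => (-δ * (((n + 1 : ℕ) + M).choose M /
        (((n + 1 : ℕ) : ℂ) - δ))) * z ^ (n + 1))
        (hypergeometricIntegral δ (M + 1) z - 1) := by
      have h3 := (hint.mul_left z).mul_left (-(δ : ℂ))
      convert! h3 using 1
      · ext n; ring
      · unfold hypergeometricIntegral; ring
    -- The leading `1` of the integral representation is exactly the term `n = 0`, as `-δ / (0 - δ)
    -- = 1`.
    have h4 : HasSum (fun n : ℕ => (-δ * ((n + M).choose M / ((n : ℂ) - δ))) * z ^ n)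
        (hypergeometricIntegral δ (M + 1) z) := by
      rw [← hasSum_nat_add_iff' 1]
      convert! hshift using 1
      have hd : (δ : ℂ) ≠ 0 := by exact_mod_cast h0.ne'
      simp [hd]
    rw [ordinaryHypergeometric_eq_tsum, ← h4.tsum_eq]
    refine tsum_congr fun n => ?_
    rw [hypergeometric_coefficient h0 h1, smul_eq_mul]
  · intro n
    refine Integrable.mul_const (Integrable.ofReal ?_) _
    have h := (integrableOn_rpow_neg h1).mul_continuousOn_of_subset
      (g' := fun t : ℝ => t ^ n) (by fun_prop) measurableSet_Ioc isCompact_Icc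
      Set.Ioc_subset_Icc_self
    exact h
  · have hterm : ∀ n : ℕ, ∫ t in Set.Ioc (0 : ℝ) 1, ‖((t ^ (-δ) * t ^ n : ℝ) : ℂ) *
        (((n + 1 + M).choose M : ℂ) * z ^ n)‖ =
        ((n + 1 + M).choose M : ℝ) / ((n + 1 : ℕ) - δ) * ‖z‖ ^ n := by
      intro n
      have : ∀ t ∈ Set.Ioc (0 : ℝ) 1, ‖((t ^ (-δ) * t ^ n : ℝ) : ℂ) *
          (((n + 1 + M).choose M : ℂ) * z ^ n)‖ =
          (t ^ (-δ) * t ^ n) * (((n + 1 + M).choose M : ℝ) * ‖z‖ ^ n) := by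
        intro t ht
        have h2 : 0 ≤ t ^ (-δ) * t ^ n := mul_nonneg (Real.rpow_nonneg ht.1.le _)
          (pow_nonneg ht.1.le _)
        rw [norm_mul, Complex.norm_real, Real.norm_of_nonneg h2, norm_mul, norm_pow,
          Complex.norm_natCast]
      rw [setIntegral_congr_fun measurableSet_Ioc this, integral_mul_const, integral_rpow_sub h1]
      ring
    simp_rw [hterm]
    have hs0 : Summable fun n : ℕ => ((n + 1 + M).choose M : ℝ) * ‖z‖ ^ n := by
      have := (hasSum_geomKernel M (u := (‖z‖ : ℂ)) (by simpa using hz)).summable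
      exact_mod_cast this
    refine Summable.of_nonneg_of_le (fun n => ?_) (fun n => ?_) (hs0.mul_left (1 - δ)⁻¹)
    · have : (0 : ℝ) < (n + 1 : ℕ) - δ := by
        push_cast
        have : (0 : ℝ) ≤ n := n.cast_nonneg
        linarith
      positivity
    · have hn : (1 - δ) ≤ (n + 1 : ℕ) - δ := by
        push_cast
        have : (0 : ℝ) ≤ n := n.cast_nonneg
        linarith
      have hpos : 0 < 1 - δ := by linarith
      rw [div_mul_eq_mul_div, div_eq_inv_mul]
      exact mul_le_mul_of_nonneg_right (inv_anti₀ hpos hn) (by positivity)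

/-- The integral shows that a continuation exists. Any chosen continuation agrees with it near `0`,
hence on the whole connected cut plane. -/
theorem gaussHypergeometric_eq_integral {δ : ℝ} (h0 : 0 < δ) (h1 : δ < 1) {N : ℕ} (hN : 1 ≤ N)
    {z : ℂ} (hz : z ∈ cutPlane) :
    gaussHypergeometric (-(δ : ℂ)) (N : ℂ) (1 - (δ : ℂ)) z = hypergeometricIntegral δ N z := by
  obtain ⟨M, rfl⟩ : ∃ M, N = M + 1 := ⟨N - 1, by omega⟩
  have hex : IsHypergeometricContinuation (-(δ : ℂ)) ((M + 1 : ℕ) : ℂ) (1 - (δ : ℂ))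
      (hypergeometricIntegral δ (M + 1)) :=
    ⟨differentiableOn_hypergeometricIntegral h1 _, fun z hz =>
      hypergeometricIntegral_eq_hypergeometric h0 h1 M (by simpa using hz)⟩
  have h : ∃ f, IsHypergeometricContinuation (-(δ : ℂ)) ((M + 1 : ℕ) : ℂ) (1 - (δ : ℂ)) f :=
    ⟨_, hex⟩
  rw [gaussHypergeometric, dif_pos h]
  have hc := h.choose_spec
  refine AnalyticOnNhd.eqOn_of_preconnected_of_eventuallyEq
    (DifferentiableOn.analyticOnNhd hc.1 isOpen_cutPlane)
    (DifferentiableOn.analyticOnNhd hex.1 isOpen_cutPlane) isPreconnected_cutPlane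
    zero_mem_cutPlane ?_ hz
  filter_upwards [Metric.ball_mem_nhds (0 : ℂ) one_pos] with z hz
  rw [hc.2 hz, hex.2 hz]

/-! ### The functions `F_α` -/

/-- The real counterpart of `geomKernel` on the negative half-axis. -/
noncomputable def geomKernelReal (N : ℕ) (u : ℝ) : ℝ := ∑ i ∈ Finset.range N, ((1 + u) ^ (i + 1))⁻¹

theorem geomKernel_neg_ofReal (N : ℕ) (u : ℝ) :
    geomKernel N ((-u : ℝ) : ℂ) = (geomKernelReal N u : ℂ) := by
  simp [geomKernel, geomKernelReal]

theorem continuousOn_geomKernelReal (N : ℕ) : ContinuousOn (geomKernelReal N) (Set.Ici 0) := by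
  unfold geomKernelReal
  refine continuousOn_finsetSum _ fun i _ => ContinuousOn.inv₀ (by fun_prop) fun u hu => ?_
  have : (0 : ℝ) ≤ u := hu
  positivity

theorem mul_geomKernelReal (N : ℕ) {u : ℝ} (hu : 0 ≤ u) :
    u * geomKernelReal N u = 1 - ((1 + u) ^ N)⁻¹ := by
  have h1 : 1 + u ≠ 0 := by positivity
  unfold geomKernelReal
  induction N with
  | zero => simp
  | succ n ih =>
    rw [Finset.sum_range_succ, mul_add, ih]
    field_simp
    ring

theorem FGeneric_eq_integral {α : ℝ} (hα : 2 < α) {N : ℕ} (hN : 1 ≤ N) {z : ℝ} (hz : 0 ≤ z) :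
    FGeneric α N z =
      2 / α * (z * ∫ t in (0 : ℝ)..1, t ^ (-(2 / α)) * geomKernelReal N (t * z)) := by
  have h0 : 0 < 2 / α := by positivity
  have h1 : 2 / α < 1 := (div_lt_one (by linarith)).2 hα
  have ha : ((-2 / α : ℝ) : ℂ) = -((2 / α : ℝ) : ℂ) := by push_cast; ring
  have hc : ((1 - 2 / α : ℝ) : ℂ) = 1 - ((2 / α : ℝ) : ℂ) := by push_cast; ring
  rw [FGeneric, ha, hc, gaussHypergeometric_eq_integral h0 h1 hN (neg_ofReal_mem_cutPlane hz)]
  have h2 : ∀ t : ℝ, ((t ^ (-(2 / α)) : ℝ) : ℂ) * geomKernel N (t * ((-z : ℝ) : ℂ)) =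
      ((t ^ (-(2 / α)) * geomKernelReal N (t * z) : ℝ) : ℂ) := by
    intro t
    have : (t : ℂ) * ((-z : ℝ) : ℂ) = ((-(t * z) : ℝ) : ℂ) := by push_cast; ring
    rw [this, geomKernel_neg_ofReal, ← Complex.ofReal_mul]
  unfold hypergeometricIntegral
  simp_rw [h2]
  rw [integral_complex_ofReal, ← Complex.ofReal_mul, ← Complex.ofReal_mul, ← Complex.ofReal_one,
    ← Complex.ofReal_sub, Complex.ofReal_re, intervalIntegral.integral_of_le zero_le_one]
  ring

/-- The substitution `u = t z` moves `z` into the upper limit and a power, so that the fundamental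
theorem of calculus gives the derivative. -/
theorem FGeneric_eq_rpow_mul {α : ℝ} (hα : 2 < α) {N : ℕ} (hN : 1 ≤ N) {z : ℝ} (hz : 0 < z) :
    FGeneric α N z =
      2 / α * (z ^ (2 / α) * ∫ u in (0 : ℝ)..z, u ^ (-(2 / α)) * geomKernelReal N u) := by
  rw [FGeneric_eq_integral hα hN hz.le]
  have h := intervalIntegral.integral_comp_mul_right (a := 0) (b := 1)
    (fun u : ℝ => u ^ (-(2 / α)) * geomKernelReal N u) hz.ne'
  rw [zero_mul, one_mul, smul_eq_mul] at h
  have h2 : ∫ t in (0 : ℝ)..1, (t * z) ^ (-(2 / α)) * geomKernelReal N (t * z) =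
      z ^ (-(2 / α)) * ∫ t in (0 : ℝ)..1, t ^ (-(2 / α)) * geomKernelReal N (t * z) := by
    rw [← intervalIntegral.integral_const_mul]
    refine intervalIntegral.integral_congr fun t ht => ?_
    rw [Set.uIcc_of_le zero_le_one] at ht
    rw [Real.mul_rpow ht.1 hz.le]
    ring
  rw [h2] at h
  have h3 : z ^ (2 / α) * z ^ (-(2 / α)) = 1 := by
    rw [← Real.rpow_add hz, add_neg_cancel, Real.rpow_zero]
  have h4 : (∫ t in (0 : ℝ)..z, t ^ (-(2 / α)) * geomKernelReal N t) =
      z * (z ^ (-(2 / α)) * ∫ t in (0 : ℝ)..1, t ^ (-(2 / α)) * geomKernelReal N (t * z)) := by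
    rw [h]; field_simp
  rw [h4]
  linear_combination (-(2 / α) * z *
    ∫ t in (0 : ℝ)..1, t ^ (-(2 / α)) * geomKernelReal N (t * z)) * h3

/-- The power `z^(2/α)` contributes `(2/α) F / z`. The moving endpoint contributes `(2/α)` times the
kernel, rewritten by `mul_geomKernelReal`. -/
theorem hasDerivAt_FGeneric {α : ℝ} (hα : 2 < α) {N : ℕ} (hN : 1 ≤ N) {z : ℝ} (hz : 0 < z) :
    HasDerivAt (FGeneric α N) (2 / α / z * (FGeneric α N z + 1 - ((1 + z) ^ N)⁻¹)) z := by
  have h1 : 2 / α < 1 := (div_lt_one (by linarith)).2 hα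
  have hcont : ContinuousOn (fun u : ℝ => u ^ (-(2 / α)) * geomKernelReal N u) (Set.Ioi 0) := by
    refine ContinuousOn.mul ?_ ((continuousOn_geomKernelReal N).mono Set.Ioi_subset_Ici_self)
    exact continuousOn_id.rpow_const fun u hu => Or.inl (ne_of_gt hu)
  have hint : IntervalIntegrable (fun u : ℝ => u ^ (-(2 / α)) * geomKernelReal N u)
      volume 0 z := by
    refine (intervalIntegral.intervalIntegrable_rpow' (by linarith)).mul_continuousOn ?_
    rw [Set.uIcc_of_le hz.le]
    exact (continuousOn_geomKernelReal N).mono fun u hu => hu.1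
  have hJ : HasDerivAt (fun z => ∫ u in (0 : ℝ)..z, u ^ (-(2 / α)) * geomKernelReal N u)
      (z ^ (-(2 / α)) * geomKernelReal N z) z :=
    intervalIntegral.integral_hasDerivAt_right hint
      (hcont.stronglyMeasurableAtFilter isOpen_Ioi z hz) (hcont.continuousAt (Ioi_mem_nhds hz))
  have hF := ((Real.hasDerivAt_rpow_const (p := 2 / α) (Or.inl hz.ne')).mul hJ).const_mul (2 / α)
  have hev : FGeneric α N =ᶠ[𝓝 z] fun z => 2 / α * (z ^ (2 / α) *
      ∫ u in (0 : ℝ)..z, u ^ (-(2 / α)) * geomKernelReal N u) := by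
    filter_upwards [lt_mem_nhds hz] with y hy
    exact FGeneric_eq_rpow_mul hα hN hy
  refine (hF.congr_of_eventuallyEq hev).congr_deriv ?_
  have h3 : z ^ (2 / α) * z ^ (-(2 / α)) = 1 := by
    rw [← Real.rpow_add hz, add_neg_cancel, Real.rpow_zero]
  have h4 : z ^ (2 / α - 1) = z ^ (2 / α) / z := by
    rw [Real.rpow_sub hz, Real.rpow_one]
  have h5 := mul_geomKernelReal N hz.le
  have h6 : FGeneric α N z + 1 - ((1 + z) ^ N)⁻¹ =
      FGeneric α N z + z * geomKernelReal N z := by rw [h5]; ring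
  rw [h6, FGeneric_eq_rpow_mul hα hN hz, h4]
  have hα0 : α ≠ 0 := by linarith
  have hz0 := hz.ne'
  generalize (∫ u in (0 : ℝ)..z, u ^ (-(2 / α)) * geomKernelReal N u) = J
  generalize geomKernelReal N z = k at *
  generalize z ^ (2 / α) = p at *
  generalize z ^ (-(2 / α)) = p' at *
  field_simp
  linear_combination (z * α * k) * h3

theorem FGeneric_zero {α : ℝ} (hα : 2 < α) {N : ℕ} (hN : 1 ≤ N) : FGeneric α N 0 = 0 := by
  rw [FGeneric_eq_integral hα hN le_rfl]; simp

theorem FTwo_zero (N : ℕ) : FTwo N 0 = 0 := by simp [FTwo]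

/-- The reindexing `d = M - c`, that is `N - c = d + 1`, removes natural subtraction from the
exponents before differentiating. -/
theorem FTwo_eq {M : ℕ} (z : ℝ) : FTwo (M + 1) z =
    z * (∑ d ∈ Finset.range M, ((M + 1 : ℕ) : ℝ) / ((z + 1) ^ (d + 1) * (d + 1))) +
      (1 - (z + 1) ^ M) / (z + 1) ^ M - z * (M + 1 : ℕ) * Real.log (1 + 1 / z) := by
  unfold FTwo
  congr 2
  rw [Finset.mul_sum, Nat.add_sub_cancel]
  refine Finset.sum_bij' (fun c _ => M - c) (fun d _ => M - d) ?_ ?_ ?_ ?_ ?_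
  · intro c hc; rw [Finset.mem_Icc] at hc; rw [Finset.mem_range]; omega
  · intro d hd; rw [Finset.mem_range] at hd; rw [Finset.mem_Icc]; omega
  · intro c hc; rw [Finset.mem_Icc] at hc; omega
  · intro d hd; rw [Finset.mem_range] at hd; omega
  · intro c hc
    rw [Finset.mem_Icc] at hc
    have h1 : M + 1 - c = M - c + 1 := by omega
    have h2 : ((M - c : ℕ) : ℝ) = M - c := by rw [Nat.cast_sub hc.2]
    rw [h1, h2]
    push_cast
    ring

theorem geom_sum_inv_pow (M : ℕ) {z : ℝ} (hz : 0 < z) :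
    z * ∑ d ∈ Finset.range M, ((z + 1) ^ (d + 2))⁻¹ = (z + 1)⁻¹ - ((z + 1) ^ (M + 1))⁻¹ := by
  have h1 : z + 1 ≠ 0 := by positivity
  induction M with
  | zero => simp
  | succ n ih =>
    rw [Finset.sum_range_succ, mul_add, ih]
    field_simp
    ring

theorem hasDerivAt_FTwo {N : ℕ} (hN : 1 ≤ N) {z : ℝ} (hz : 0 < z) :
    HasDerivAt (FTwo N) (1 / z * (FTwo N z + 1 - ((1 + z) ^ N)⁻¹)) z := by
  obtain ⟨M, rfl⟩ : ∃ M, N = M + 1 := ⟨N - 1, by omega⟩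
  have h1 : z + 1 ≠ 0 := by positivity
  have hz0 := hz.ne'
  have hid : HasDerivAt (fun z : ℝ => z + 1) 1 z := (hasDerivAt_id z).add_const 1
  have hS : HasDerivAt (fun z : ℝ => ∑ d ∈ Finset.range M,
      ((M + 1 : ℕ) : ℝ) / ((z + 1) ^ (d + 1) * (d + 1)))
      (∑ d ∈ Finset.range M, -(((M + 1 : ℕ) : ℝ) * ((z + 1) ^ (d + 2))⁻¹)) z := by
    refine HasDerivAt.fun_sum fun d _ => ?_
    have hd : (d : ℝ) + 1 ≠ 0 := by positivity
    have h2 := ((hid.fun_pow (d + 1)).mul_const ((d : ℝ) + 1)).fun_inv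
      (mul_ne_zero (pow_ne_zero _ h1) hd)
    refine (h2.const_mul ((M + 1 : ℕ) : ℝ)).congr_deriv ?_
    rw [Nat.add_sub_cancel]
    push_cast
    field_simp
    ring
  have hG : HasDerivAt (fun z : ℝ => (1 - (z + 1) ^ M) / (z + 1) ^ M)
      (-(M * ((z + 1) ^ (M + 1))⁻¹)) z := by
    have h2 : HasDerivAt (fun z : ℝ => ((z + 1) ^ M)⁻¹ - 1)
        (-(M * (z + 1) ^ (M - 1) * 1) / ((z + 1) ^ M) ^ 2) z :=
      ((hid.fun_pow M).fun_inv (pow_ne_zero _ h1)).sub_const 1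
    have hev : (fun z : ℝ => (1 - (z + 1) ^ M) / (z + 1) ^ M) =ᶠ[𝓝 z]
        fun z : ℝ => ((z + 1) ^ M)⁻¹ - 1 := by
      filter_upwards [lt_mem_nhds hz] with y hy
      have : y + 1 ≠ 0 := by positivity
      field_simp
    refine (h2.congr_of_eventuallyEq hev).congr_deriv ?_
    -- For `M = 0` the exponent `M - 1` is truncated, but the factor `M` makes the term vanish.
    rcases M with _ | M
    · simp
    · rw [Nat.add_sub_cancel]
      field_simp
      ring
  have hL : HasDerivAt (fun z : ℝ => Real.log (1 + 1 / z)) (-(1 / (z * (z + 1)))) z := by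
    have h2 : HasDerivAt (fun z : ℝ => 1 + 1 / z) (-(z ^ 2)⁻¹) z := by
      simpa [one_div] using (hasDerivAt_inv hz0).const_add 1
    refine (h2.log (by positivity)).congr_deriv ?_
    field_simp
  have hF := (((hasDerivAt_id z).mul hS).add hG).sub
    (((hasDerivAt_id z).mul_const ((M + 1 : ℕ) : ℝ)).mul hL)
  have hfun : FTwo (M + 1) = fun z => z * (∑ d ∈ Finset.range M,
      ((M + 1 : ℕ) : ℝ) / ((z + 1) ^ (d + 1) * (d + 1))) +
      (1 - (z + 1) ^ M) / (z + 1) ^ M - z * (M + 1 : ℕ) * Real.log (1 + 1 / z) :=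
    funext fun z => FTwo_eq z
  rw [FTwo_eq z, hfun]
  refine hF.congr_deriv ?_
  have key := geom_sum_inv_pow M hz
  rw [Finset.sum_neg_distrib, ← Finset.mul_sum]
  generalize (∑ d ∈ Finset.range M, ((z + 1) ^ (d + 2))⁻¹) = S at *
  generalize (∑ d ∈ Finset.range M, ((M + 1 : ℕ) : ℝ) / ((z + 1) ^ (d + 1) * (d + 1))) = S'
  generalize Real.log (1 + 1 / z) = L
  have hS' : S = ((z + 1)⁻¹ - ((z + 1) ^ (M + 1))⁻¹) / z := by rw [← key]; field_simp
  rw [hS', add_comm 1 z]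
  simp only [id]
  push_cast
  field_simp
  ring

/-- Together with `FAlpha_zero`, this equation is all that the computation of `Z` uses about the
closed forms; at `α = 2` the coefficient `2/α` is `1`. -/
theorem hasDerivAt_FAlpha {α : ℝ} (hα : 2 ≤ α) {N : ℕ} (hN : 1 ≤ N) {z : ℝ} (hz : 0 < z) :
    HasDerivAt (FAlpha α N) (2 / α / z * (FAlpha α N z + 1 - ((1 + z) ^ N)⁻¹)) z := by
  rcases hα.eq_or_lt with rfl | h
  · have : FAlpha 2 N = FTwo N := funext fun z => by simp [FAlpha]
    rw [this, div_self two_ne_zero]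
    exact hasDerivAt_FTwo hN hz
  · have : FAlpha α N = FGeneric α N := funext fun z => by simp [FAlpha, h.ne']
    rw [this]
    exact hasDerivAt_FGeneric h hN hz

theorem FAlpha_zero {α : ℝ} (hα : 2 ≤ α) {N : ℕ} (hN : 1 ≤ N) : FAlpha α N 0 = 0 := by
  rcases hα.eq_or_lt with rfl | h
  · simp [FAlpha, FTwo_zero]
  · simp [FAlpha, h.ne', FGeneric_zero h hN]

/-! ### The functions `Z` as radial integrals -/

namespace DownlinkParams

variable {P : DownlinkParams}

/-- The Laplace transform of the received power over a link in the state `κ` with gain `g`. -/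
noncomputable def linkLaplace (P : DownlinkParams) (κ : Link) (s g r : ℝ) : ℝ :=
  ((1 + s * (P.pathLoss κ r * g) / P.Nak κ) ^ P.Nak κ)⁻¹

theorem dh_nonneg (P : DownlinkParams) : 0 ≤ P.dh := abs_nonneg _

theorem pathLoss_eq (P : DownlinkParams) (κ : Link) (r : ℝ) :
    P.pathLoss κ r = P.C κ / (r ^ 2 + P.dh ^ 2) ^ (P.α κ / 2) := by
  have h : 0 ≤ r ^ 2 + P.dh ^ 2 := by positivity
  rw [pathLoss, Real.sqrt_eq_rpow, ← Real.rpow_mul h]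
  ring_nf

theorem laplace_arg_eq (P : DownlinkParams) (κ : Link) (s g r : ℝ) :
    s * (P.pathLoss κ r * g) / P.Nak κ =
      s * P.C κ * g / (P.Nak κ * (r ^ 2 + P.dh ^ 2) ^ (P.α κ / 2)) := by
  rw [pathLoss_eq, mul_comm (P.Nak κ : ℝ), ← div_div]
  ring

theorem Admissible.laplace_arg_nonneg (hP : P.Admissible) (κ : Link) {s g : ℝ} (hs : 0 ≤ s)
    (hg : 0 ≤ g) (r : ℝ) : 0 ≤ s * (P.pathLoss κ r * g) / P.Nak κ := by
  have h1 := hP.pathLoss_nonneg κ r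
  positivity

theorem Admissible.linkLaplace_pos (hP : P.Admissible) (κ : Link) {s g : ℝ} (hs : 0 ≤ s)
    (hg : 0 ≤ g) (r : ℝ) : 0 < P.linkLaplace κ s g r := by
  have h1 := hP.laplace_arg_nonneg κ hs hg r
  unfold linkLaplace
  positivity

theorem Admissible.linkLaplace_le_one (hP : P.Admissible) (κ : Link) {s g : ℝ} (hs : 0 ≤ s)
    (hg : 0 ≤ g) (r : ℝ) : P.linkLaplace κ s g r ≤ 1 := by
  have h1 := hP.laplace_arg_nonneg κ hs hg r
  exact inv_le_one_of_one_le₀ (one_le_pow₀ (by linarith))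

theorem measurable_linkLaplace (P : DownlinkParams) (κ : Link) (s g : ℝ) :
    Measurable (P.linkLaplace κ s g) := by
  unfold linkLaplace; fun_prop

/-- Put `y = a² + dh²` and let `z` be the argument of `F`, a constant times `y^(-α/2)`. Then `d/dy
(y F / 2) = F/2 - (α/4) z F'`, and the differential equation reduces this to `-(1 - (1 + z)⁻ᴺ)/2`.
The factor `dy/da = 2a` finishes the computation. -/
theorem Admissible.hasDerivAt_ZPart (hP : P.Admissible) (hα : ∀ κ, 2 ≤ P.α κ) (κ : Link)
    {s g a : ℝ} (hs : 0 ≤ s) (hg : 0 ≤ g) (ha : 0 < a) :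
    HasDerivAt (fun a => P.ZPart κ s a g) (-(a * (1 - P.linkLaplace κ s g a))) a := by
  have hN : (0 : ℝ) < P.Nak κ := by exact_mod_cast hP.Nak_pos κ
  have hC := hP.C_pos κ
  -- If `s g = 0` the argument of `F` is `0`, where the differential equation is not available; both
  -- sides then vanish.
  rcases (mul_nonneg hs hg).eq_or_lt with h0 | h0
  · have hz : s * P.C κ * g = 0 := by linear_combination -(P.C κ) * h0
    have h1 : (fun a => P.ZPart κ s a g) = fun _ => 0 := by
      ext b
      simp [ZPart, hz, FAlpha_zero (hα κ) (hP.Nak_pos κ)]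
    have h2 : P.linkLaplace κ s g a = 1 := by
      rw [linkLaplace, laplace_arg_eq, hz]; simp
    rw [h1, h2]
    simpa using hasDerivAt_const a (0 : ℝ)
  · have hs' : 0 < s := lt_of_le_of_ne hs fun h => by simp [← h] at h0
    have hg' : 0 < g := lt_of_le_of_ne hg fun h => by simp [← h] at h0
    have hy : 0 < a ^ 2 + P.dh ^ 2 := by positivity
    have hα0 : 0 < P.α κ := by linarith [hα κ]
    have hyd : HasDerivAt (fun a : ℝ => a ^ 2 + P.dh ^ 2) (2 * a) a := by
      simpa using (hasDerivAt_pow 2 a).add_const (P.dh ^ 2)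
    have hpd := hyd.rpow_const (p := P.α κ / 2) (Or.inl hy.ne')
    have hpow : 0 < (a ^ 2 + P.dh ^ 2) ^ (P.α κ / 2) := Real.rpow_pos_of_pos hy _
    have hzd := ((hpd.const_mul (P.Nak κ : ℝ)).fun_inv (mul_pos hN hpow).ne').const_mul
      (s * P.C κ * g)
    have hz : 0 < s * P.C κ * g * ((P.Nak κ : ℝ) * (a ^ 2 + P.dh ^ 2) ^ (P.α κ / 2))⁻¹ := by
      positivity
    have hFd := (hasDerivAt_FAlpha (hα κ) (hP.Nak_pos κ) hz).comp a hzd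
    have hmain := (hyd.div_const 2).mul hFd
    unfold ZPart
    refine HasDerivAt.congr_deriv (f := fun a => (a ^ 2 + P.dh ^ 2) / 2 * FAlpha (P.α κ) (P.Nak κ)
      (s * P.C κ * g / (P.Nak κ * (a ^ 2 + P.dh ^ 2) ^ (P.α κ / 2)))) hmain ?_
    rw [linkLaplace, laplace_arg_eq, Real.rpow_sub_one hy.ne', ← div_eq_mul_inv]
    simp only [Function.comp]
    rw [← div_eq_mul_inv]
    generalize FAlpha (P.α κ) (P.Nak κ) _ = F
    generalize ((1 + s * P.C κ * g / (P.Nak κ * (a ^ 2 + P.dh ^ 2) ^ (P.α κ / 2))) ^ P.Nak κ)⁻¹ = x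
    generalize (a ^ 2 + P.dh ^ 2) ^ (P.α κ / 2) = p at *
    generalize a ^ 2 + P.dh ^ 2 = y at *
    field_simp
    ring

theorem continuousOn_linkLaplace (hP : P.Admissible) (κ : Link) {s g : ℝ} (hs : 0 ≤ s)
    (hg : 0 ≤ g) : ContinuousOn (P.linkLaplace κ s g) (Set.Ioi 0) := by
  unfold linkLaplace
  refine ContinuousOn.inv₀ ?_ fun r _ => ?_
  · simp_rw [pathLoss_eq]
    have h1 : ContinuousOn (fun r : ℝ => (r ^ 2 + P.dh ^ 2) ^ (P.α κ / 2)) (Set.Ioi 0) := by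
      refine ContinuousOn.rpow_const (by fun_prop) fun r hr => Or.inl ?_
      have : (0 : ℝ) < r := hr
      positivity
    have h2 : ContinuousOn (fun r : ℝ => P.C κ / (r ^ 2 + P.dh ^ 2) ^ (P.α κ / 2)) (Set.Ioi 0) := by
      refine continuousOn_const.div h1 fun r hr => (Real.rpow_pos_of_pos ?_ _).ne'
      have : (0 : ℝ) < r := hr
      positivity
    fun_prop
  · have := hP.laplace_arg_nonneg κ hs hg r
    positivity

theorem Admissible.Z_eq_integral (hP : P.Admissible) (hα : ∀ κ, 2 ≤ P.α κ) (κ : Link)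
    {s g a b : ℝ} (hs : 0 ≤ s) (hg : 0 ≤ g) (ha : 0 < a) (hab : a ≤ b) :
    P.Z κ s a b g = ∫ r in a..b, r * (1 - P.linkLaplace κ s g r) := by
  have hpos : ∀ r ∈ Set.uIcc a b, 0 < r := fun r hr => by
    rw [Set.uIcc_of_le hab] at hr
    exact lt_of_lt_of_le ha hr.1
  have h := intervalIntegral.integral_eq_sub_of_hasDerivAt
    (fun r hr => (hP.hasDerivAt_ZPart hα κ hs hg (hpos r hr)).neg) ?_
  · simp only [neg_neg, Pi.neg_apply] at h
    rw [h, Z]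
    ring
  · refine ContinuousOn.intervalIntegrable ?_
    simp only [neg_neg]
    exact continuousOn_id.mul (continuousOn_const.sub
      ((continuousOn_linkLaplace hP κ hs hg).mono hpos))

theorem rate_pos (hP : P.Admissible) : 0 < P.rate :=
  Real.sqrt_pos.2 (mul_pos hP.betaA_pos hP.betaB_pos)

theorem γ_eq (hP : P.Admissible) {j : ℕ} {r : ℝ}
    (hr : r ∈ Set.Ico ((j : ℝ) / P.rate) ((j + 1) / P.rate)) : P.γ r = j := by
  have h := rate_pos hP
  have h0 : 0 ≤ r := le_trans (by positivity) hr.1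
  rw [γ, Nat.floor_eq_iff (by positivity)]
  exact ⟨(div_le_iff₀ h).1 hr.1, (lt_div_iff₀ h).1 hr.2⟩

theorem mem_annulus (hP : P.Admissible) {r : ℝ} (hr : 0 ≤ r) :
    r ∈ Set.Ico ((P.γ r : ℝ) / P.rate) ((P.γ r + 1) / P.rate) := by
  have h := rate_pos hP
  exact ⟨(div_le_iff₀ h).2 (Nat.floor_le (by positivity)),
    (lt_div_iff₀ h).2 (Nat.lt_floor_add_one _)⟩

theorem linkProb_mul_Z_eq (hP : P.Admissible) (hα : ∀ κ, 2 ≤ P.α κ) (κ : Link) {s g a b : ℝ}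
    (hs : 0 ≤ s) (hg : 0 ≤ g) (ha : 0 < a) (hab : a ≤ b) {j : ℕ}
    (hj : ∀ r ∈ Set.Ico a b, P.γ r = j) :
    P.linkProb κ j * P.Z κ s a b g =
      ∫ r in Set.Ico a b, P.linkProb κ (P.γ r) * (r * (1 - P.linkLaplace κ s g r)) := by
  -- The interval integral lives on `(a, b]`, whereas the floor is constant on `[a, b)`; endpoints
  -- are exchanged as null sets.
  rw [hP.Z_eq_integral hα κ hs hg ha hab, intervalIntegral.integral_of_le hab,
    integral_Ioc_eq_integral_Ioo, ← integral_Ico_eq_integral_Ioo, ← integral_const_mul]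
  exact setIntegral_congr_fun measurableSet_Ico fun r hr => by simp only [hj r hr]

theorem integrableOn_radial (hP : P.Admissible) (κ : Link) {s g : ℝ} (hs : 0 ≤ s) (hg : 0 ≤ g)
    {a b : ℝ} (ha : 0 ≤ a) :
    IntegrableOn (fun r => P.linkProb κ (P.γ r) * (r * (1 - P.linkLaplace κ s g r)))
      (Set.Ico a b) := by
  have hm : Measurable fun r => P.linkProb κ (P.γ r) * (r * (1 - P.linkLaplace κ s g r)) :=
    (P.measurable_linkProb κ).mul
      (measurable_id.mul (measurable_const.sub (P.measurable_linkLaplace κ s g)))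
  refine Measure.integrableOn_of_bounded (M := b) measure_Ico_lt_top.ne
    hm.aestronglyMeasurable ?_
  filter_upwards [ae_restrict_mem measurableSet_Ico] with r hr
  have h0 : 0 ≤ r := ha.trans hr.1
  have h1 := P.linkProb_nonneg κ (P.γ r)
  have h2 := P.linkProb_le_one κ (P.γ r)
  have h3 := (hP.linkLaplace_pos κ hs hg r).le
  have h4 := sub_nonneg.2 (hP.linkLaplace_le_one κ hs hg r)
  rw [Real.norm_of_nonneg (by positivity)]
  calc P.linkProb κ (P.γ r) * (r * (1 - P.linkLaplace κ s g r)) ≤ 1 * (r * 1) := by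
        gcongr
        linarith
    _ ≤ b := by linarith [hr.2]

/-- The head runs from `r₁` to the next multiple of `1 / rate`, and each term adds one full annulus,
so `J` terms reach the radius `(γ r₁ + 1 + J) / rate`. -/
theorem ThetaPartial_eq_integral (hP : P.Admissible) (hα : ∀ κ, 2 ≤ P.α κ) (κ : Link)
    {s g r₁ : ℝ} (hs : 0 ≤ s) (hg : 0 ≤ g) (hr : 0 < r₁) (J : ℕ) :
    P.ThetaPartial J κ s g r₁ = ∫ r in Set.Ico r₁ (((P.γ r₁ + 1 + J : ℕ) : ℝ) / P.rate),
      P.linkProb κ (P.γ r) * (r * (1 - P.linkLaplace κ s g r)) := by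
  have hR := rate_pos hP
  have hmem := mem_annulus hP hr.le
  induction J with
  | zero =>
    simp only [ThetaPartial, thetaHead, Finset.range_zero, Finset.sum_empty, add_zero]
    push_cast
    refine linkProb_mul_Z_eq hP hα κ hs hg hr hmem.2.le fun r h => γ_eq hP ⟨?_, h.2⟩
    exact hmem.1.trans h.1
  | succ J ih =>
    have h1 : P.ThetaPartial (J + 1) κ s g r₁ =
        P.ThetaPartial J κ s g r₁ + P.thetaTerm κ s g (P.γ r₁ + 1 + J) := by
      simp only [ThetaPartial, Finset.sum_range_succ]; ring
    have hle1 : r₁ ≤ ((P.γ r₁ + 1 + J : ℕ) : ℝ) / P.rate := by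
      refine hmem.2.le.trans (div_le_div_of_nonneg_right ?_ hR.le)
      push_cast
      have : (0 : ℝ) ≤ J := J.cast_nonneg
      linarith
    have hle2 : ((P.γ r₁ + 1 + J : ℕ) : ℝ) / P.rate ≤ ((P.γ r₁ + 1 + (J + 1) : ℕ) : ℝ) / P.rate := by
      refine div_le_div_of_nonneg_right ?_ hR.le
      exact_mod_cast (by omega)
    have hcast : ((P.γ r₁ + 1 + (J + 1) : ℕ) : ℝ) = ((P.γ r₁ + 1 + J : ℕ) : ℝ) + 1 := by
      push_cast; ring
    have h2 : P.thetaTerm κ s g (P.γ r₁ + 1 + J) =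
        ∫ r in Set.Ico (((P.γ r₁ + 1 + J : ℕ) : ℝ) / P.rate)
          (((P.γ r₁ + 1 + (J + 1) : ℕ) : ℝ) / P.rate),
          P.linkProb κ (P.γ r) * (r * (1 - P.linkLaplace κ s g r)) := by
      rw [hcast] at hle2 ⊢
      exact linkProb_mul_Z_eq hP hα κ hs hg (hr.trans_le hle1) hle2 fun r h => γ_eq hP h
    rw [h1, h2, ih, ← Set.Ico_union_Ico_eq_Ico hle1 hle2,
      setIntegral_union (Set.disjoint_left.2 fun r h1 h2 => absurd h2.1 (not_le.2 h1.2))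
        measurableSet_Ico (integrableOn_radial hP κ hs hg hr.le)
        (integrableOn_radial hP κ hs hg (hr.le.trans hle1))]

/-! ### Convergence of the series -/

theorem Admissible.Z_nonneg (hP : P.Admissible) (hα : ∀ κ, 2 ≤ P.α κ) (κ : Link)
    {s g a b : ℝ} (hs : 0 ≤ s) (hg : 0 ≤ g) (ha : 0 < a) (hab : a ≤ b) : 0 ≤ P.Z κ s a b g := by
  rw [hP.Z_eq_integral hα κ hs hg ha hab]
  refine intervalIntegral.integral_nonneg hab fun r hr => mul_nonneg (ha.le.trans hr.1) ?_
  exact sub_nonneg.2 (hP.linkLaplace_le_one κ hs hg r)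

theorem Admissible.Z_le (hP : P.Admissible) (hα : ∀ κ, 2 ≤ P.α κ) (κ : Link)
    {s g a b K : ℝ} (hs : 0 ≤ s) (hg : 0 ≤ g) (ha : 0 < a) (hab : a ≤ b)
    (hK : ∀ r ∈ Set.Ioc a b, r * (1 - P.linkLaplace κ s g r) ≤ K) :
    P.Z κ s a b g ≤ K * (b - a) := by
  have h := intervalIntegral.norm_integral_le_of_norm_le_const (a := a) (b := b) (C := K)
    (f := fun r => r * (1 - P.linkLaplace κ s g r)) fun r hr => by
      rw [Set.uIoc_of_le hab] at hr
      rw [Real.norm_of_nonneg (mul_nonneg (ha.le.trans hr.1.le)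
        (sub_nonneg.2 (hP.linkLaplace_le_one κ hs hg r)))]
      exact hK r hr
  rw [← hP.Z_eq_integral hα κ hs hg ha hab, abs_of_nonneg (sub_nonneg.2 hab)] at h
  exact (le_abs_self _).trans h

/-- The LOS probability decays geometrically in the number of obstacles. -/
theorem exists_losProb_le (hP : P.Admissible) :
    ∃ q : ℝ, 0 ≤ q ∧ q < 1 ∧ ∀ k : ℕ, 1 ≤ k → P.losProb k ≤ q ^ (k + 1) := by
  -- For `n ≤ k` and `k ≥ 1` one has `n + 1/2 ≤ 2 k`, so the squared difference is at most `k² (max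
  -- + 2 dh)²`. The `k²` cancels, giving the same bound `1 - exp (-B)` for all `k + 1` factors.
  obtain ⟨B, hB⟩ : ∃ B : ℝ, B = (max P.hv P.hb + 2 * P.dh) ^ 2 / (2 * P.eps ^ 2) := ⟨_, rfl⟩
  have heps := hP.eps_pos
  have hmax : 0 ≤ max P.hv P.hb := le_max_of_le_left hP.hv_nonneg
  have hdh := P.dh_nonneg
  have hB0 : 0 ≤ B := by rw [hB]; positivity
  refine ⟨1 - Real.exp (-B), ?_, by linarith [Real.exp_pos (-B)], fun k hk => ?_⟩
  · simpa using hB0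
  · rw [losProb, if_neg (by omega)]
    rw [← Finset.card_range (k + 1), ← Finset.prod_const, Finset.card_range]
    have hk1 : (1 : ℝ) ≤ k := by exact_mod_cast hk
    refine Finset.prod_le_prod (fun n _ => ?_) fun n hn => ?_
    · rw [sub_nonneg, Real.exp_le_one_iff, neg_nonpos]
      positivity
    · have hnk : (n : ℝ) ≤ k := by
        rw [Finset.mem_range] at hn
        exact_mod_cast (by omega : n ≤ k)
      have hn0 : (0 : ℝ) ≤ n := n.cast_nonneg
      refine sub_le_sub_left (Real.exp_le_exp.2 (neg_le_neg ?_)) 1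
      have habs : |k * max P.hv P.hb - (n + 1 / 2) * P.dh| ≤
          k * (max P.hv P.hb + 2 * P.dh) := by
        rw [abs_le]
        constructor <;> nlinarith
      have hsq : (k * max P.hv P.hb - (n + 1 / 2) * P.dh) ^ 2 ≤
          (k * (max P.hv P.hb + 2 * P.dh)) ^ 2 := sq_le_sq' (abs_le.1 habs).1 (abs_le.1 habs).2
      rw [hB, div_le_div_iff₀ (by positivity) (by positivity)]
      nlinarith [mul_le_mul_of_nonneg_right hsq (by positivity : (0 : ℝ) ≤ 2 * P.eps ^ 2)]

/-- Bernoulli's inequality for `((1 + u)⁻¹)ᴺ`, combined with `(1 + u)⁻¹ ≥ 1 - u`. -/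
theorem one_sub_inv_pow_le (N : ℕ) {u : ℝ} (hu : 0 ≤ u) : 1 - ((1 + u) ^ N)⁻¹ ≤ N * u := by
  have h1 : (0 : ℝ) < 1 + u := by positivity
  have h2 : 1 - u ≤ (1 + u)⁻¹ := by
    rw [← one_div, le_div_iff₀ h1]; nlinarith
  have h3 := one_add_mul_le_pow (a := (1 + u)⁻¹ - 1) (by
    have : 0 < (1 + u)⁻¹ := by positivity
    linarith) N
  rw [add_sub_cancel, inv_pow] at h3
  have hN : (0 : ℝ) ≤ N := N.cast_nonneg
  nlinarith

theorem summable_thetaTerm_of_succ {κ : Link} {s g : ℝ}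
    (h : Summable fun j : ℕ => P.thetaTerm κ s g (j + 1)) (k : ℕ) :
    Summable fun m : ℕ => P.thetaTerm κ s g (k + 1 + m) := by
  have := (summable_nat_add_iff k).2 h
  refine this.congr fun m => ?_
  rw [show m + k + 1 = k + 1 + m by ring]

/-- The area of an annulus grows only linearly in its index while the LOS probability decays
geometrically, so the trivial bound `1 - linkLaplace ≤ 1` suffices. -/
theorem summable_thetaTerm_L (hP : P.Admissible) (hα : ∀ κ, 2 ≤ P.α κ) {s g : ℝ} (hs : 0 ≤ s)
    (hg : 0 ≤ g) : Summable fun j : ℕ => P.thetaTerm Link.L s g (j + 1) := by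
  obtain ⟨q, hq0, hq1, hq⟩ := exists_losProb_le hP
  have hR := rate_pos hP
  have hsum : Summable fun j : ℕ => (((j + 2 : ℕ) : ℝ) ^ 1 * q ^ (j + 2)) * (1 / P.rate ^ 2) := by
    have h1 := summable_pow_mul_geometric_of_norm_lt_one 1 (r := q)
      (by rwa [Real.norm_of_nonneg hq0])
    exact ((summable_nat_add_iff 2).2 h1).mul_right _
  have hab : ∀ j : ℕ, ((j + 1 : ℕ) : ℝ) / P.rate ≤ (((j + 1 : ℕ) : ℝ) + 1) / P.rate := fun j =>
    div_le_div_of_nonneg_right (by linarith) hR.le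
  have ha : ∀ j : ℕ, 0 < ((j + 1 : ℕ) : ℝ) / P.rate := fun j => by positivity
  refine Summable.of_nonneg_of_le (fun j => ?_) (fun j => ?_) hsum
  · exact mul_nonneg (P.linkProb_nonneg _ _) (hP.Z_nonneg hα _ hs hg (ha j) (hab j))
  · have hZ := hP.Z_le hα Link.L (K := (((j + 1 : ℕ) : ℝ) + 1) / P.rate) hs hg (ha j) (hab j)
      fun r hr => by
        have h1 := (hP.linkLaplace_pos Link.L hs hg r).le
        have h2 : 0 ≤ r := (ha j).le.trans hr.1.le
        nlinarith [hr.2]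
    have hp : P.losProb (j + 1) ≤ q ^ (j + 2) := hq (j + 1) (by omega)
    calc P.thetaTerm Link.L s g (j + 1)
        ≤ q ^ (j + 2) * ((((j + 1 : ℕ) : ℝ) + 1) / P.rate *
          ((((j + 1 : ℕ) : ℝ) + 1) / P.rate - ((j + 1 : ℕ) : ℝ) / P.rate)) :=
        mul_le_mul hp hZ (hP.Z_nonneg hα _ hs hg (ha j) (hab j)) (by positivity)
      _ = _ := by
        push_cast
        field_simp
        ring

/-- The path loss is at most `C r^(-α)`, so the radial integrand is at most `s C g r^(1-α)`, and `1
- α < -1`. The link probability is simply bounded by `1`. -/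
theorem summable_thetaTerm_of_two_lt (hP : P.Admissible) (hα : ∀ κ, 2 ≤ P.α κ) {κ : Link}
    (hκ : 2 < P.α κ) {s g : ℝ} (hs : 0 ≤ s) (hg : 0 ≤ g) :
    Summable fun j : ℕ => P.thetaTerm κ s g (j + 1) := by
  have hR := rate_pos hP
  have hC := hP.C_pos κ
  have hN : (0 : ℝ) < P.Nak κ := by exact_mod_cast hP.Nak_pos κ
  have hsum : Summable fun j : ℕ => ((j + 1 : ℕ) : ℝ) ^ (1 - P.α κ) *
      (s * P.C κ * g * (P.rate ^ (1 - P.α κ))⁻¹ * P.rate⁻¹) := by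
    have h1 := Real.summable_nat_rpow.2 (by linarith : 1 - P.α κ < -1)
    exact ((summable_nat_add_iff 1).2 h1).mul_right _
  have hab : ∀ j : ℕ, ((j + 1 : ℕ) : ℝ) / P.rate ≤ (((j + 1 : ℕ) : ℝ) + 1) / P.rate := fun j =>
    div_le_div_of_nonneg_right (by linarith) hR.le
  have ha : ∀ j : ℕ, 0 < ((j + 1 : ℕ) : ℝ) / P.rate := fun j => by positivity
  refine Summable.of_nonneg_of_le (fun j => ?_) (fun j => ?_) hsum
  · exact mul_nonneg (P.linkProb_nonneg _ _) (hP.Z_nonneg hα _ hs hg (ha j) (hab j))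
  · have hZ := hP.Z_le hα κ (K := s * P.C κ * g * (((j + 1 : ℕ) : ℝ) / P.rate) ^ (1 - P.α κ))
      hs hg (ha j) (hab j) fun r hr => by
        have hr0 : 0 < r := (ha j).trans hr.1
        have h1 := one_sub_inv_pow_le (P.Nak κ) (hP.laplace_arg_nonneg κ hs hg r)
        have hrα : r ^ P.α κ ≤ (r ^ 2 + P.dh ^ 2) ^ (P.α κ / 2) := by
          have h2 : r ^ P.α κ = (r ^ 2) ^ (P.α κ / 2) := by
            rw [← Real.rpow_natCast, ← Real.rpow_mul hr0.le]
            congr 1; push_cast; ring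
          rw [h2]
          exact Real.rpow_le_rpow (by positivity) (by nlinarith [sq_nonneg P.dh]) (by linarith)
        have hrpos : 0 < r ^ P.α κ := Real.rpow_pos_of_pos hr0 _
        have h3 : (P.Nak κ : ℝ) * (s * (P.pathLoss κ r * g) / P.Nak κ) ≤
            s * P.C κ * g * (r ^ P.α κ)⁻¹ := by
          rw [laplace_arg_eq]
          have : (P.Nak κ : ℝ) * (s * P.C κ * g /
              (P.Nak κ * (r ^ 2 + P.dh ^ 2) ^ (P.α κ / 2))) =
              s * P.C κ * g * ((r ^ 2 + P.dh ^ 2) ^ (P.α κ / 2))⁻¹ := by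
            field_simp
          rw [this]
          exact mul_le_mul_of_nonneg_left (inv_anti₀ hrpos hrα) (by positivity)
        calc r * (1 - P.linkLaplace κ s g r)
            ≤ r * (s * P.C κ * g * (r ^ P.α κ)⁻¹) :=
              mul_le_mul_of_nonneg_left (h1.trans h3) hr0.le
          _ = s * P.C κ * g * r ^ (1 - P.α κ) := by
              rw [Real.rpow_sub hr0, Real.rpow_one]; ring
          _ ≤ _ := mul_le_mul_of_nonneg_left
              (Real.rpow_le_rpow_of_nonpos (ha j) hr.1.le (by linarith)) (by positivity)
    calc P.thetaTerm κ s g (j + 1)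
        ≤ 1 * (s * P.C κ * g * (((j + 1 : ℕ) : ℝ) / P.rate) ^ (1 - P.α κ) *
          ((((j + 1 : ℕ) : ℝ) + 1) / P.rate - ((j + 1 : ℕ) : ℝ) / P.rate)) :=
        mul_le_mul (P.linkProb_le_one _ _) hZ (hP.Z_nonneg hα _ hs hg (ha j) (hab j)) zero_le_one
      _ = _ := by
        rw [Real.div_rpow (by positivity) hR.le]
        field_simp
        ring

end DownlinkParams

/-! ### The intensity of the interference in polar coordinates -/

/-- The constant `2π` is the dimension times the area of the unit disc; the boundary circles do not
matter. -/
theorem integral_annulus_norm (f : ℝ → ℝ) {a b : ℝ} (ha : 0 < a) :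
    ∫ x in {x : EuclideanSpace ℝ (Fin 2) | a < ‖x‖ ∧ ‖x‖ < b}, f ‖x‖ =
      2 * Real.pi * ∫ r in Set.Ico a b, r * f r := by
  have hm : MeasurableSet {x : EuclideanSpace ℝ (Fin 2) | a < ‖x‖ ∧ ‖x‖ < b} :=
    measurable_norm measurableSet_Ioo
  have h := integral_fun_norm_addHaar (volume : Measure (EuclideanSpace ℝ (Fin 2)))
    ((Set.Ioo a b).indicator f)
  have h1 : ∫ x : EuclideanSpace ℝ (Fin 2), (Set.Ioo a b).indicator f ‖x‖ =
      ∫ x in {x : EuclideanSpace ℝ (Fin 2) | a < ‖x‖ ∧ ‖x‖ < b}, f ‖x‖ := by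
    rw [← integral_indicator hm]
    rfl
  have h2 : volume.real (Metric.ball (0 : EuclideanSpace ℝ (Fin 2)) 1) = Real.pi := by
    rw [measureReal_def, EuclideanSpace.volume_ball_fin_two]
    simp [Real.pi_pos.le]
  have h3 : ∫ y in Set.Ioi (0 : ℝ), y ^ (2 - 1) • (Set.Ioo a b).indicator f y =
      ∫ r in Set.Ico a b, r * f r := by
    have e : ∀ y : ℝ, y ^ (2 - 1) • (Set.Ioo a b).indicator f y =
        (Set.Ioo a b).indicator (fun r => r * f r) y := by
      intro y
      by_cases hy : y ∈ Set.Ioo a b <;> simp [hy]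
    simp_rw [e]
    rw [setIntegral_indicator measurableSet_Ioo, integral_Ico_eq_integral_Ioo]
    congr 2
    exact Set.inter_eq_right.2 fun y hy => ha.trans hy.1
  rw [h1, finrank_euclideanSpace_fin, h2, h3] at h
  rw [h]
  simp only [smul_eq_mul, nsmul_eq_mul]
  push_cast
  ring

theorem setLIntegral_annulus_norm {f : ℝ → ℝ} (hf : Measurable f) (h0 : ∀ r, 0 ≤ f r)
    (h1 : ∀ r, f r ≤ 1) {lam : ℝ} (hlam : 0 ≤ lam) {a b : ℝ} (ha : 0 < a) :
    ∫⁻ x in {x : EuclideanSpace ℝ (Fin 2) | a < ‖x‖ ∧ ‖x‖ < b}, ENNReal.ofReal (f ‖x‖)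
        ∂(ENNReal.ofReal lam • volume) =
      ENNReal.ofReal (2 * Real.pi * lam * ∫ r in Set.Ico a b, r * f r) := by
  have hfin : volume {x : EuclideanSpace ℝ (Fin 2) | a < ‖x‖ ∧ ‖x‖ < b} ≠ ∞ := by
    refine ((measure_mono fun x hx => ?_).trans_lt
      (measure_ball_lt_top (x := (0 : EuclideanSpace ℝ (Fin 2))) (r := b))).ne
    simpa using hx.2
  rw [Measure.restrict_smul, lintegral_smul_measure, ← ofReal_integral_eq_lintegral_ofReal,
    integral_annulus_norm f ha, smul_eq_mul, ← ENNReal.ofReal_mul hlam]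
  · congr 1; ring
  · refine Measure.integrableOn_of_bounded (M := 1) hfin
      (hf.comp measurable_norm).aestronglyMeasurable (ae_of_all _ fun x => ?_)
    rw [Real.norm_of_nonneg (h0 _)]
    exact h1 _
  · exact ae_of_all _ fun x => h0 _

theorem tendsto_setLIntegral_annulus {E : Type*} [NormedAddCommGroup E] [MeasurableSpace E]
    [BorelSpace E] (Λ : Measure E) {g : E → ℝ≥0∞} (hg : Measurable g) (a : ℝ) {b : ℕ → ℝ}
    (hmono : Monotone b) (hb : Tendsto b atTop atTop) :
    Tendsto (fun J => ∫⁻ x in {x | a < ‖x‖ ∧ ‖x‖ < b J}, g x ∂Λ) atTop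
      (𝓝 (∫⁻ x in {x | a < ‖x‖}, g x ∂Λ)) := by
  have hm : ∀ J, MeasurableSet {x : E | a < ‖x‖ ∧ ‖x‖ < b J} := fun J =>
    measurable_norm measurableSet_Ioo
  have hm2 : MeasurableSet {x : E | a < ‖x‖} := measurable_norm measurableSet_Ioi
  simp_rw [← lintegral_indicator (hm _), ← lintegral_indicator hm2]
  refine lintegral_tendsto_of_tendsto_of_monotone (fun J => (hg.indicator (hm J)).aemeasurable)
    (ae_of_all _ fun x m n hmn => ?_) (ae_of_all _ fun x => ?_)
  · refine Set.indicator_le_indicator_of_subset (fun y hy => ?_) (fun _ => zero_le) x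
    exact ⟨hy.1, hy.2.trans_le (hmono hmn)⟩
  · refine tendsto_const_nhds.congr' ?_
    filter_upwards [hb.eventually_gt_atTop ‖x‖] with J hJ
    by_cases hx : a < ‖x‖ <;> simp [Set.indicator, hx, hJ]

namespace DownlinkParams

variable {P : DownlinkParams}

theorem sum_ThetaPartial_eq (hP : P.Admissible) (hα : ∀ κ, 2 ≤ P.α κ) {s r₁ : ℝ}
    (hs : 0 ≤ s) (hr : 0 < r₁) (J : ℕ) :
    ∑ i : Fin 4, P.gainProb i * (P.ThetaPartial J Link.L s (P.gain i) r₁ +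
      P.ThetaPartial J Link.N s (P.gain i) r₁) =
      ∫ r in Set.Ico r₁ (((P.γ r₁ + 1 + J : ℕ) : ℝ) / P.rate), r * (1 - P.markLaplace s r) := by
  have h1 : ∀ r, r * (1 - P.markLaplace s r) = ∑ c : Link × Fin 4, P.gainProb c.2 *
      (P.linkProb c.1 (P.γ r) * (r * (1 - P.linkLaplace c.1 s (P.gain c.2) r))) := by
    intro r
    rw [one_sub_markLaplace, Finset.mul_sum]
    refine Finset.sum_congr rfl fun c _ => ?_
    simp only [stateLaplace, linkLaplace]
    ring
  simp_rw [h1]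
  rw [integral_finsetSum _ fun c _ =>
    (integrableOn_radial hP c.1 hs (hP.gain_nonneg c.2) hr.le).const_mul _]
  simp_rw [integral_const_mul]
  rw [Fintype.sum_prod_type_right]
  refine Finset.sum_congr rfl fun i _ => ?_
  simp only [Link.sum_univ]
  rw [ThetaPartial_eq_integral hP hα _ hs (hP.gain_nonneg i) hr,
    ThetaPartial_eq_integral hP hα _ hs (hP.gain_nonneg i) hr]
  ring

theorem expNeg_log_markLaplace (hP : P.Admissible) {s : ℝ} (hs : 0 ≤ s) (r : ℝ) :
    expNeg (ENNReal.ofReal (-Real.log (P.markLaplace s r))) = P.markLaplace s r := by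
  rw [expNeg_ofReal (neg_nonneg.2 (Real.log_nonpos (hP.markLaplace_pos hs _).le
    (hP.markLaplace_le_one hs _))), neg_neg, Real.exp_log (hP.markLaplace_pos hs _)]

/-- Monotone convergence in the outer radius, followed by continuity of `expNeg` at the limit. No
summability is needed: a divergent integral gives `expNeg ∞ = 0`. -/
theorem tendsto_exp_ThetaPartial (hP : P.Admissible) (hα : ∀ κ, 2 ≤ P.α κ) {s r₁ : ℝ}
    (hs : 0 ≤ s) (hr : 0 < r₁) :
    Tendsto (fun J : ℕ => Real.exp (-2 * Real.pi * P.lam * ∑ i : Fin 4, P.gainProb i *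
        (P.ThetaPartial J Link.L s (P.gain i) r₁ + P.ThetaPartial J Link.N s (P.gain i) r₁)))
      atTop (𝓝 (expNeg (∫⁻ x in {x : EuclideanSpace ℝ (Fin 2) | r₁ < ‖x‖},
        ENNReal.ofReal (1 - expNeg (ENNReal.ofReal (-Real.log (P.markLaplace s ‖x‖))))
        ∂(ENNReal.ofReal P.lam • volume)))) := by
  have hR := rate_pos hP
  have hlam := hP.lam_pos
  simp_rw [expNeg_log_markLaplace hP hs, sum_ThetaPartial_eq hP hα hs hr]
  have hm : Measurable fun r => 1 - P.markLaplace s r :=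
    measurable_const.sub (P.measurable_markLaplace s)
  have h0 : ∀ r, 0 ≤ 1 - P.markLaplace s r := fun r => sub_nonneg.2 (hP.markLaplace_le_one hs r)
  have h1 : ∀ r, 1 - P.markLaplace s r ≤ 1 := fun r => by linarith [hP.markLaplace_pos hs r]
  have hexp : ∀ J : ℕ, Real.exp (-2 * Real.pi * P.lam *
      ∫ r in Set.Ico r₁ (((P.γ r₁ + 1 + J : ℕ) : ℝ) / P.rate), r * (1 - P.markLaplace s r)) =
      expNeg (∫⁻ x in {x : EuclideanSpace ℝ (Fin 2) | r₁ < ‖x‖ ∧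
        ‖x‖ < ((P.γ r₁ + 1 + J : ℕ) : ℝ) / P.rate}, ENNReal.ofReal (1 - P.markLaplace s ‖x‖)
        ∂(ENNReal.ofReal P.lam • volume)) := by
    intro J
    rw [setLIntegral_annulus_norm hm h0 h1 hlam.le hr, expNeg_ofReal]
    · congr 1; ring
    · refine mul_nonneg (by positivity) (setIntegral_nonneg measurableSet_Ico fun r hr' => ?_)
      exact mul_nonneg (hr.le.trans hr'.1) (h0 r)
  simp_rw [hexp]
  refine (continuous_expNeg.tendsto _).comp (tendsto_setLIntegral_annulus _
    (ENNReal.measurable_ofReal.comp (hm.comp measurable_norm)) r₁ ?_ ?_)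
  · intro m n hmn
    refine div_le_div_of_nonneg_right ?_ hR.le
    exact_mod_cast (by omega)
  · refine Tendsto.atTop_div_const hR (tendsto_natCast_atTop_atTop.comp ?_)
    exact tendsto_atTop_mono (fun J : ℕ => show J ≤ P.γ r₁ + 1 + J by omega) tendsto_id

end DownlinkParams

/-! ### The conditional transform given the nearest distance, and the final formula. -/

namespace IsDownlinkNetwork

variable {Ω : Type*} [MeasurableSpace Ω] {μ : Measure Ω} [IsProbabilityMeasure μ]
  {P : DownlinkParams} {v : ℕ → Ω → EuclideanSpace ℝ (Fin 2)} {link : ℕ → Ω → Link}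
  {pat : ℕ → Ω → Fin 4} {fad : ℕ → Ω → ℝ}

instance sigmaFinite_intensity (P : DownlinkParams) :
    SigmaFinite (ENNReal.ofReal P.lam • (volume : Measure (EuclideanSpace ℝ (Fin 2)))) :=
  inferInstanceAs (SigmaFinite (P.lam.toNNReal • (volume : Measure (EuclideanSpace ℝ (Fin 2)))))

/-- The Laplace functional with the test function `∞` on `{0}` equals `1`, since `{0}` has zero
intensity; it would be `0` on any event with a point at the origin. This supplies the `r₁ > 0`
needed for the radial formulas. -/
theorem ae_norm_nearest_pos (hnet : IsDownlinkNetwork μ P v link pat fad) :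
    ∀ᵐ ω ∂μ, 0 < ‖v 0 ω‖ := by
  have h0 : (ENNReal.ofReal P.lam • (volume : Measure (EuclideanSpace ℝ (Fin 2)))) {0} = 0 := by
    simp
  have h := hnet.poisson.laplace (f := ({0} : Set (EuclideanSpace ℝ (Fin 2))).indicator
    fun _ => ∞) (measurable_const.indicator (measurableSet_singleton 0))
  have h1 : ∫⁻ x, ENNReal.ofReal (1 - expNeg (({0} : Set (EuclideanSpace ℝ (Fin 2))).indicator
      (fun _ => ∞) x)) ∂(ENNReal.ofReal P.lam • volume) = 0 := by
    rw [← lintegral_zero (μ := ENNReal.ofReal P.lam • (volume : Measure (EuclideanSpace ℝ (Fin 2))))]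
    refine lintegral_congr_ae ?_
    have hae : ∀ᵐ x ∂(ENNReal.ofReal P.lam • (volume : Measure (EuclideanSpace ℝ (Fin 2)))),
        x ≠ 0 := by
      rw [ae_iff]; simp
    filter_upwards [hae] with x hx
    simp [hx]
  rw [h1, expNeg_zero] at h
  have hmeas : Measurable fun ω => ∫⁻ x, ({0} : Set (EuclideanSpace ℝ (Fin 2))).indicator
      (fun _ => ∞) x ∂(Measure.sum fun n => Measure.dirac (v n ω)) :=
    hnet.poisson.measurable_lintegral (measurable_const.indicator (measurableSet_singleton 0))
  have h2 : ∫ ω, (1 - expNeg (∫⁻ x, ({0} : Set (EuclideanSpace ℝ (Fin 2))).indicator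
      (fun _ => ∞) x ∂(Measure.sum fun n => Measure.dirac (v n ω)))) ∂μ = 0 := by
    rw [integral_sub (integrable_const _) (integrable_expNeg hmeas.aemeasurable), h]
    simp
  rw [integral_eq_zero_iff_of_nonneg (fun ω => sub_nonneg.2 (expNeg_le_one _))
    ((integrable_const _).sub (integrable_expNeg hmeas.aemeasurable))] at h2
  filter_upwards [h2] with ω hω
  by_contra hcon
  have hv : v 0 ω = 0 := by simpa using hcon
  have htop : ∫⁻ x, ({0} : Set (EuclideanSpace ℝ (Fin 2))).indicator (fun _ => ∞) x
      ∂(Measure.sum fun n => Measure.dirac (v n ω)) = ∞ := by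
    rw [lintegral_sum_measure]
    refine ENNReal.tsum_eq_top_of_eq_top ⟨0, ?_⟩
    rw [lintegral_dirac, hv]
    simp
  simp only [htop, expNeg_top, Pi.zero_apply] at hω
  norm_num at hω

/-- The candidate is an antitone function of `r₁` followed by `expNeg`, hence measurable for
`nearestSigma`. On an event `r₁ ∈ A`, averaging over the marks and then over the points beyond the
nearest gives the required equality of integrals. -/
theorem condLaplace_ae_eq (hP : P.Admissible) (hnet : IsDownlinkNetwork μ P v link pat fad)
    {s : ℝ} (hs : 0 ≤ s) :
    ∀ᵐ ω ∂μ, condLaplace μ P v link pat fad s ω =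
      expNeg (∫⁻ x in {x : EuclideanSpace ℝ (Fin 2) | ‖v 0 ω‖ < ‖x‖},
        ENNReal.ofReal (1 - expNeg (ENNReal.ofReal (-Real.log (P.markLaplace s ‖x‖))))
        ∂(ENNReal.ofReal P.lam • volume)) := by
  have hm : nearestSigma v ≤ (inferInstance : MeasurableSpace Ω) :=
    (hnet.measurable_v 0).norm.comap_le
  have hanti : Antitone fun t : ℝ => ∫⁻ x in {x : EuclideanSpace ℝ (Fin 2) | t < ‖x‖},
      ENNReal.ofReal (1 - expNeg (ENNReal.ofReal (-Real.log (P.markLaplace s ‖x‖))))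
        ∂(ENNReal.ofReal P.lam • volume) :=
    fun a b hab => lintegral_mono_set fun x hx => lt_of_le_of_lt hab hx
  have hHm : Measurable[nearestSigma v] fun ω => expNeg (∫⁻ x in
      {x : EuclideanSpace ℝ (Fin 2) | ‖v 0 ω‖ < ‖x‖},
        ENNReal.ofReal (1 - expNeg (ENNReal.ofReal (-Real.log (P.markLaplace s ‖x‖))))
        ∂(ENNReal.ofReal P.lam • volume)) :=
    (measurable_expNeg.comp hanti.measurable).comp (comap_measurable _)
  have hfm : Measurable fun x : EuclideanSpace ℝ (Fin 2) =>
      ENNReal.ofReal (-Real.log (P.markLaplace s ‖x‖)) :=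
    ENNReal.measurable_ofReal.comp (Real.measurable_log.comp
      ((P.measurable_markLaplace s).comp measurable_norm)).neg
  have hIm : Measurable fun ω => ENNReal.ofReal s * interference P v link pat fad ω := by
    refine Measurable.const_mul (Measurable.tsum fun n => ?_) _
    have h1 : Measurable fun ω => P.pathLoss (link n ω) ‖v (n + 1) ω‖ := by
      have : Measurable fun z : ℝ × Link => P.pathLoss z.2 z.1 :=
        measurable_from_prod_countable_left fun κ => P.measurable_pathLoss κ
      exact this.comp ((hnet.measurable_v (n + 1)).norm.prodMk (hnet.measurable_link n))
    have h2 : Measurable fun ω => P.gain (pat n ω) :=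
      (measurable_of_finite P.gain).comp (hnet.measurable_pat n)
    exact ENNReal.measurable_ofReal.comp ((h1.mul h2).mul (hnet.measurable_fad n))
  have hHint : Integrable (fun ω => expNeg (∫⁻ x in
      {x : EuclideanSpace ℝ (Fin 2) | ‖v 0 ω‖ < ‖x‖},
        ENNReal.ofReal (1 - expNeg (ENNReal.ofReal (-Real.log (P.markLaplace s ‖x‖))))
        ∂(ENNReal.ofReal P.lam • volume))) μ :=
    integrable_expNeg (hanti.measurable.comp (hnet.measurable_v 0).norm).aemeasurable
  have key := ae_eq_condExp_of_forall_setIntegral_eq (μ := μ) hm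
    (integrable_expNeg hIm.aemeasurable) (fun _ _ _ => hHint.integrableOn) ?_
    hHm.aestronglyMeasurable
  · filter_upwards [key] with ω hω
    exact hω.symm
  · rintro _ ⟨A, hA, rfl⟩ -
    have h1 := setIntegral_expNeg_interference hP hnet hs
      (B := {x | ‖x 0‖ ∈ A}) ((measurable_pi_apply 0).norm hA)
    have h2 := hnet.poisson.setIntegral_expNeg_nearest hnet.measurable_v hnet.ranked hfm hA
    exact (h1.trans h2).symm

end IsDownlinkNetwork

theorem lemma1 {Ω : Type*} [MeasurableSpace Ω] (μ : Measure Ω) [IsProbabilityMeasure μ]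
    (P : DownlinkParams) (hP : P.Admissible) (hα : ∀ κ, 2 ≤ P.α κ)
    (v : ℕ → Ω → EuclideanSpace ℝ (Fin 2)) (link : ℕ → Ω → Link) (pat : ℕ → Ω → Fin 4)
    (fad : ℕ → Ω → ℝ) (hnet : IsDownlinkNetwork μ P v link pat fad)
    (s : ℝ) (hs : 0 ≤ s) :
    (∀ (i : Fin 4) (r₁ : ℝ), 0 < r₁ →
      Summable (fun m : ℕ => P.thetaTerm Link.L s (P.gain i) (P.γ r₁ + 1 + m)) ∧
      (2 < P.α Link.N →
        Summable (fun m : ℕ => P.thetaTerm Link.N s (P.gain i) (P.γ r₁ + 1 + m)))) ∧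
    (2 < P.α Link.N →
      ∀ᵐ ω ∂μ, condLaplace μ P v link pat fad s ω =
        Real.exp (-2 * Real.pi * P.lam * ∑ i : Fin 4, P.gainProb i *
          (P.Theta Link.L s (P.gain i) ‖v 0 ω‖ + P.Theta Link.N s (P.gain i) ‖v 0 ω‖))) ∧
    (∀ᵐ ω ∂μ, Tendsto
      (fun J : ℕ => Real.exp (-2 * Real.pi * P.lam * ∑ i : Fin 4, P.gainProb i *
        (P.ThetaPartial J Link.L s (P.gain i) ‖v 0 ω‖
          + P.ThetaPartial J Link.N s (P.gain i) ‖v 0 ω‖)))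
      atTop (𝓝 (condLaplace μ P v link pat fad s ω))) := by
  have hL : ∀ (i : Fin 4) (r₁ : ℝ),
      Summable (fun m : ℕ => P.thetaTerm Link.L s (P.gain i) (P.γ r₁ + 1 + m)) := fun i r₁ =>
    DownlinkParams.summable_thetaTerm_of_succ
      (DownlinkParams.summable_thetaTerm_L hP hα hs (hP.gain_nonneg i)) _
  have hN : 2 < P.α Link.N → ∀ (i : Fin 4) (r₁ : ℝ),
      Summable (fun m : ℕ => P.thetaTerm Link.N s (P.gain i) (P.γ r₁ + 1 + m)) := fun h i r₁ =>
    DownlinkParams.summable_thetaTerm_of_succ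
      (DownlinkParams.summable_thetaTerm_of_two_lt hP hα h hs (hP.gain_nonneg i)) _
  have hlim : ∀ᵐ ω ∂μ, Tendsto
      (fun J : ℕ => Real.exp (-2 * Real.pi * P.lam * ∑ i : Fin 4, P.gainProb i *
        (P.ThetaPartial J Link.L s (P.gain i) ‖v 0 ω‖
          + P.ThetaPartial J Link.N s (P.gain i) ‖v 0 ω‖)))
      atTop (𝓝 (condLaplace μ P v link pat fad s ω)) := by
    filter_upwards [hnet.condLaplace_ae_eq hP hs, hnet.ae_norm_nearest_pos] with ω hω hpos
    rw [hω]
    exact DownlinkParams.tendsto_exp_ThetaPartial hP hα hs hpos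
  refine ⟨fun i r₁ _ => ⟨hL i r₁, fun h => hN h i r₁⟩, fun h => ?_, hlim⟩
  filter_upwards [hlim] with ω hω
  -- When both series converge, the partial sums also tend to `Theta`, so uniqueness of limits turns
  -- the limit statement into the closed formula.
  refine tendsto_nhds_unique hω ((Real.continuous_exp.tendsto _).comp
    (Tendsto.const_mul _ (tendsto_finsetSum _ fun i _ => Tendsto.const_mul _ ?_)))
  exact ((hL i _).hasSum.tendsto_sum_nat.const_add _).add
    ((hN h i _).hasSum.tendsto_sum_nat.const_add _)
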